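/- **Setting.** Let $(\Omega,\mathcal F,P)$ be a probability space and $\sigma$ the surface measure on the unit sphere $\mathbb S^2\subset\mathbb R^3$, $\sigma(\mathbb S^2)=4\pi$. Let $Y_{l,m}$ ($l\in\mathbb N_0$, $-l\le m\le l$) be the standard complex orthonormal spherical harmonics of degree $l$ and order $m$. Let $\Gamma\subsetneq\mathbb S^2$ be a measurable set with nonempty interior, and let $\mathcal A(T)=T$ on $\Gamma$, $\mathcal A(T)=0$ on $\mathbb S^2\setminus\Gamma$. Fix $0<p<1$, $\eta>1$, and the weights $\beta_0=1$, $\beta_l=\eta^l l^p$ for $l\ge1$. For $\alpha=(\alpha_{l\cdot})_{l\ge 0}$ with $\alpha_{l\cdot}=(\alpha_{l,-l},\dots,\alpha_{l,l})^T\in\mathbb C^{2l+1}$ let $\|\alpha_{l\cdot}\|$ be the Euclidean norm, and let $$\ell^p_\beta=\Big\{\alpha:\ \sum_l\|\alpha_{l\cdot}\|^2<\infty,\ \sum_l\beta_l\|\alpha_{l\cdot}\|^p<\infty\Big\}.$$ Let $Y$ be the infinite matrix with entries $\int_\Gamma\overline{Y_{l,m}}\,Y_{l',m'}\,d\sigma$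 (row $(l,m)$, column $(l',m')$). For $T^\circ\in L_2(\mathbb S^2)$ real-valued and $\varrho\in\mathbb R$ put $\alpha^\circ_{l,m}=\int_\Gamma T^\circ\,\overline{Y_{l,m}}\,d\sigma$, $c=\int_{\mathbb S^2}|T^\circ|^2d\sigma$ and $g(\alpha)=\alpha^HY\alpha-2\,\mathrm{Re}(\alpha^H\alpha^\circ)+c$. A *scaled KKT point* of the problem $\min\{\sum_l\beta_l\|\alpha_{l\cdot}\|^p:\alpha\in\ell^p_\beta,\ g(\alpha)\le\varrho\}$ is an $\alpha^*\in\ell^p_\beta$ for which there is a $\nu\ge0$ with $$p\beta_l\|\alpha^*_{l\cdot}\|^p\alpha^*_{l\cdot}+2\nu\|\alpha^*_{l\cdot}\|^2\big((Y\alpha^*)_{l\cdot}-\alpha^\circ_{l\cdot}\big)=0\quad(l\in\mathbb N_0),\qquad \nu\,(g(\alpha^*)-\varrho)=0,\qquad g(\alpha^*)\le\varrho .$$ **Theorem 5.2.** Let $T^\circ\in L_2(\Omega\times\mathbb S^2)=L_2(P\otimes\sigma)$ be real-valued (the observed random field), and let $\varrho$ be a constant with $$\int_{\mathbb S^2\setminus\Gamma}|T^\circ(\omega,\mathrm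 x)|^2d\sigma(\mathrm x)<\varrho<\int_{\mathbb S^2}|T^\circ(\omega,\mathrm x)|^2d\sigma(\mathrm x)\qquad\text{for } P\text{-a.e. }\omega .$$ Let $\alpha^*_{l,m}:\Omega\to\mathbb C$ be random variables such that, for $P$-a.e. $\omega$, $\alpha^*(\omega)$ is a scaled KKT point of the above problem for $T^\circ(\omega,\cdot)$, and let $$T^*(\omega,\mathrm x)=\sum_{l=0}^\infty\sum_{m=-l}^l\alpha^*_{l,m}(\omega)Y_{l,m}(\mathrm x),\qquad T^*_L(\omega,\mathrm x)=\sum_{l=0}^L\sum_{m=-l}^l\alpha^*_{l,m}(\omega)Y_{l,m}(\mathrm x).$$ Suppose that there are a map $\xi$ from $\Omega$ to a normed space with $\mathbb E\|\xi\|^2<\infty$ and a constant $\kappa\ge 0$ such that $\|T^*(\omega_1,\cdot)-T^*(\omega_2,\cdot)\|_{L_2(\mathbb S^2)}\le\kappa\|\xi(\omega_1)-\xi(\omega_2)\|$ for $P$-a.e. $\omega_1$ and $P$-a.e. $\omega_2$ (for instance $\Omega$ is a subset of a normed space and $\xi(\omega)=\omega$; the condition also holds whenever $T^*\in L_2(\Omega\times\mathbb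 S^2)$). Then for every $\epsilon>0$ there is an $L\in\mathbb N_0$ such that $\mathcal A(T^*_L)-T^\circ\in L_2(\Omega\times\mathbb S^2)$ and $$0\le\|\mathcal A(T^*_L)-T^\circ\|^2_{L_2(\Omega\times\mathbb S^2)}-\varrho<\epsilon .$$ -/

import Mathlib

open MeasureTheory
open scoped ENNReal NNReal ComplexConjugate

noncomputable section

namespace SphereInpainting

/-- The unit sphere of `ℝ³`. -/
abbrev S2 : Type := Metric.sphere (0 : EuclideanSpace ℝ (Fin 3)) 1

/-- The surface measure of the unit sphere, of total mass `4π`. -/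
def sigma : Measure S2 := (volume : Measure (EuclideanSpace ℝ (Fin 3))).toSphere

/-- The Legendre polynomial of degree `l`, by Rodrigues' formula. -/
def legendre (l : ℕ) : Polynomial ℝ :=
  Polynomial.C (1 / (2 ^ l * (l.factorial : ℝ))) *
    Polynomial.derivative^[l] ((Polynomial.X ^ 2 - 1) ^ l)

/-- The spherical harmonic of degree `l` and order `m` with `0 ≤ m ≤ l`. With
`x = (sin θ cos φ, sin θ sin φ, cos θ)` one has `sin θ ^ m * exp (i m φ) = (x₀ + i x₁) ^ m`, so that
this is `√((2l+1)/(4π) · (l-m)!/(l+m)!) · P_l^m(cos θ) · exp (i m φ)`, where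
`P_l^m(t) = (-1)^m (1 - t²)^(m/2) P_l⁽ᵐ⁾(t)` is the associated Legendre function. -/
def sphHarmNat (l m : ℕ) (x : S2) : ℂ :=
  (-1) ^ m *
    (Real.sqrt ((2 * l + 1) / (4 * Real.pi) *
      (((l - m).factorial : ℝ) / ((l + m).factorial : ℝ))) : ℂ) *
    (((x.1 0 : ℝ) : ℂ) + Complex.I * ((x.1 1 : ℝ) : ℂ)) ^ m *
    (((Polynomial.derivative^[m] (legendre l)).eval (x.1 2) : ℝ) : ℂ)

/-- The (complex, orthonormal) spherical harmonic `Y_{l,m}` of degree `l` and order `m`,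
`-l ≤ m ≤ l`, with `Y_{l,-m} = (-1)^m conj Y_{l,m}`. -/
def sphHarm (l : ℕ) (m : ℤ) (x : S2) : ℂ :=
  if 0 ≤ m then sphHarmNat l m.natAbs x
  else (-1) ^ m.natAbs * conj (sphHarmNat l m.natAbs x)

/-- The orders `m = -l, …, l` that belong to degree `l`. -/
abbrev Orders (l : ℕ) : Type := Finset.Icc (-(l : ℤ)) (l : ℤ)

/-- Coefficient vectors in their group structure: the group `α l` is a vector of `ℂ^(2l+1)`
with the `ℓ²` norm. -/
abbrev Coeff : Type := (l : ℕ) → EuclideanSpace ℂ (Orders l)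

/-- The degree-`l` part `∑_{m=-l}^{l} α_{l,m} Y_{l,m}` of a field. -/
def degreePart (α : Coeff) (l : ℕ) (x : S2) : ℂ :=
  ∑ m : Orders l, α l m * sphHarm l m x

/-- The field `∑_{l=0}^∞ ∑_{m=-l}^{l} α_{l,m} Y_{l,m}`. -/
def field (α : Coeff) (x : S2) : ℂ := ∑' l : ℕ, degreePart α l x

/-- The truncated field `∑_{l=0}^L ∑_{m=-l}^{l} α_{l,m} Y_{l,m}`. -/
def truncField (L : ℕ) (α : Coeff) (x : S2) : ℂ :=
  ∑ l ∈ Finset.range (L + 1), degreePart α l x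

/-- The inpainting operator: it keeps a field on `Γ` and replaces it by `0` off `Γ`. -/
def inpaint (Γ : Set S2) (T : S2 → ℂ) : S2 → ℂ := Γ.indicator T

/-- The weights `β_0 = 1`, `β_l = η^l l^p` for `l ≥ 1`. -/
def weight (η p : ℝ) (l : ℕ) : ℝ := if l = 0 then 1 else η ^ l * (l : ℝ) ^ p

/-- The weighted space `ℓ^p_β`. -/
def MemEll (η p : ℝ) (α : Coeff) : Prop :=
  (Summable fun l => ‖α l‖ ^ 2) ∧ Summable fun l => weight η p l * ‖α l‖ ^ p

/-- The entry `∫_Γ conj Y_{l,m} · Y_{l',m'} dσ` of the infinite matrix `Y`, for which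
`αᴴ Y α = ∫_Γ |∑ α_{l,m} Y_{l,m}|² dσ`. -/
def gram (Γ : Set S2) (l : ℕ) (m : ℤ) (l' : ℕ) (m' : ℤ) : ℂ :=
  ∫ x in Γ, conj (sphHarm l m x) * sphHarm l' m' x ∂sigma

/-- The group `(Y α)_{l·}`. -/
def gramMul (Γ : Set S2) (α : Coeff) : Coeff := fun l =>
  WithLp.toLp 2 fun m : Orders l =>
    ∑' l' : ℕ, ∑ m' : Orders l', gram Γ l m l' m' * α l' m'

/-- The vector `α°` with entries `∫_Γ T° · conj Y_{l,m} dσ`. -/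
def obsCoeff (Γ : Set S2) (To : S2 → ℝ) : Coeff := fun l =>
  WithLp.toLp 2 fun m : Orders l => ∫ x in Γ, (To x : ℂ) * conj (sphHarm l m x) ∂sigma

/-- The product `αᴴ b = ∑_l ∑_m conj α_{l,m} · b_{l,m}`. -/
def hdot (α b : Coeff) : ℂ := ∑' l : ℕ, ∑ m : Orders l, conj (α l m) * b l m

/-- The constraint function `αᴴ Y α - 2 Re (αᴴ α°) + c` with `c = ∫ |T°|² dσ`. -/
def constraintFn (Γ : Set S2) (To : S2 → ℝ) (α : Coeff) : ℝ :=
  (hdot α (gramMul Γ α)).re - 2 * (hdot α (obsCoeff Γ To)).re + ∫ x, To x ^ 2 ∂sigma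

/-- `α` is a scaled KKT point of the problem of minimizing `∑_l β_l ‖α_{l·}‖^p` over `ℓ^p_β`
subject to `αᴴ Y α - 2 Re (αᴴ α°) + c ≤ ϱ`. -/
def IsScaledKKT (η p rho : ℝ) (Γ : Set S2) (To : S2 → ℝ) (α : Coeff) : Prop :=
  MemEll η p α ∧ ∃ ν : ℝ,
    (∀ l : ℕ, (p * weight η p l * ‖α l‖ ^ p) • α l +
      (2 * ν * ‖α l‖ ^ 2) • (gramMul Γ α l - obsCoeff Γ To l) = 0) ∧
    ν * (constraintFn Γ To α - rho) = 0 ∧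
    constraintFn Γ To α ≤ rho ∧
    0 ≤ ν

end SphereInpainting

end

namespace SphereInpainting

/-! The argument is pathwise, followed by dominated convergence in `L`. For a typical outcome let
a_l be the groups of the KKT point and r_l = (Yα)_l - α°_l the residual groups.

Finite support (`IsScaledKKT.exists_forall_eq_zero`). Since a_l tends to 0 and p < 1, eventually
‖a_l‖ ≤ ‖a_l‖^p. Taking norms in the stationarity equation and cancelling ‖a_l‖² leaves p β_l ≤ 2ν
‖r_l‖ whenever a_l ≠ 0. But ‖r_l‖ grows at most linearly in l and β_l exponentially, so a_l = 0 for
large l. All series become finite sums, and the constraint function is the squared misfit of the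
field.

Active constraint (`IsScaledKKT.constraintFn_eq`). A zero multiplier would force α = 0, whose misfit
∫ |T°|² exceeds rho. So the full field has misfit exactly rho.

Truncation cannot lower the misfit (`IsScaledKKT.exists_misfit`). Stationarity gives Re ⟨a_l, r_l⟩ ≤
0. Removing the tail D changes the misfit by -2 Re ∑ ⟨a_l, r_l⟩ + ∫_Γ |D|² ≥ 0, the sum being over
the removed degrees.

The degree from which the misfit equals rho depends on the outcome, so after integration rho is
reached only as a limit. A dominating function comes from the Lipschitz condition
(`exists_memLp_bound`) together with Parseval's identity for truncations.

Parseval, and the bound 1 on the Gram entries, rest on orthonormality of the explicit harmonics. It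
combines integrals of Legendre derivatives, Archimedes' theorem and invariance under rotations. -/

/-! ### Legendre polynomials: orthogonality and norms of their derivatives -/

open Polynomial in
/-- The differential equation satisfied by the derivatives of `(X² - 1)^l`. -/
theorem iterate_derivative_sq_sub_one_pow (l k : ℕ) :
    (X ^ 2 - 1) * derivative^[k + 2] ((X ^ 2 - 1 : ℝ[X]) ^ l) +
      C (2 * ((k : ℝ) + 1) - 2 * l) * X * derivative^[k + 1] ((X ^ 2 - 1 : ℝ[X]) ^ l) +
      C (((k : ℝ) + 1) * (k - 2 * l)) * derivative^[k] ((X ^ 2 - 1 : ℝ[X]) ^ l) = 0 := by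
  -- A first-order equation for the power; differentiating it once gives `k = 0`, and each further
  -- differentiation raises `k` by one.
  have base : (X ^ 2 - 1) * derivative ((X ^ 2 - 1 : ℝ[X]) ^ l) =
      C (2 * (l : ℝ)) * X * (X ^ 2 - 1 : ℝ[X]) ^ l := by
    rcases l with _ | l
    · simp
    · rw [derivative_pow]
      simp only [derivative_sub, derivative_X_pow, derivative_one, map_mul, map_natCast,
        Nat.add_sub_cancel]
      push_cast
      simp only [map_ofNat]
      ring
  induction k with
  | zero =>
    have h := congrArg derivative base
    simp only [derivative_mul, derivative_sub, derivative_X_pow, derivative_one, derivative_C,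
      derivative_X] at h
    simp only [Function.iterate_succ, Function.iterate_zero, Function.comp_apply, id_eq,
      Nat.cast_zero, zero_add, map_sub, map_mul, map_ofNat, map_natCast, zero_sub,
      map_neg, Nat.cast_ofNat, mul_one, one_mul] at h ⊢
    linear_combination h
  | succ k ih =>
    have h := congrArg derivative ih
    simp only [derivative_add, derivative_mul, derivative_sub, derivative_X_pow, derivative_one,
      derivative_C, derivative_X, ← Function.iterate_succ_apply' derivative, derivative_zero] at h
    simp only [map_sub, map_mul, map_one, map_ofNat, map_natCast, map_add, Nat.cast_ofNat,
      Nat.succ_eq_add_one] at h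
    simp only [map_sub, map_mul, map_one, map_ofNat, map_natCast, map_add, Nat.cast_add,
      Nat.cast_one, add_right_comm k 1]
    rw [show k + 1 + 2 = k + 2 + 1 by ring, show k + 1 + 1 = k + 2 by ring] at *
    linear_combination h

open Polynomial in
/-- The differential equation of the `m`-th derivative of a Legendre polynomial. -/
theorem legendre_ode (l m : ℕ) :
    derivative ((1 - X ^ 2) ^ (m + 1) * derivative^[m + 1] (legendre l)) =
      -C (((l : ℝ) - m) * (l + m + 1)) * ((1 - X ^ 2) ^ m * derivative^[m] (legendre l)) := by
  have key : (X ^ 2 - 1) * derivative^[m + 2] (legendre l) +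
      C (2 * ((m : ℝ) + 1)) * X * derivative^[m + 1] (legendre l) =
      C (((l : ℝ) - m) * (l + m + 1)) * derivative^[m] (legendre l) := by
    have h := iterate_derivative_sq_sub_one_pow l (m + l)
    simp only [legendre, iterate_derivative_C_mul, ← Function.iterate_add_apply]
    rw [show m + l + 2 = m + 2 + l by ring, show m + l + 1 = m + 1 + l by ring] at h
    simp only [map_sub, map_mul, map_one, map_ofNat, map_natCast, map_add, Nat.cast_add] at h ⊢
    linear_combination (C (1 / (2 ^ l * (l.factorial : ℝ)))) * h
  rw [derivative_mul, derivative_pow, ← Function.iterate_succ_apply' derivative]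
  simp only [derivative_X_pow, derivative_one,
    map_mul, map_natCast, Nat.add_sub_cancel, map_add, map_sub, map_ofNat, map_one,
    Nat.succ_eq_add_one, Nat.cast_add, Nat.cast_one, Nat.cast_ofNat] at key ⊢
  rw [show m + 1 + 1 = m + 2 by ring]
  linear_combination (-(1 - X ^ 2) ^ m) * key

open Polynomial in
/-- The fundamental theorem of calculus for polynomials on `[-1, 1]`. -/
theorem integral_derivative_eval (q : ℝ[X]) :
    ∫ t in (-1 : ℝ)..1, (derivative q).eval t = q.eval 1 - q.eval (-1) :=
  intervalIntegral.integral_eq_sub_of_hasDerivAt (fun t _ => q.hasDerivAt t)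
    (derivative q).continuous.continuousOn.intervalIntegrable

open Polynomial in
/-- The inner product of the `m`-th derivatives of two Legendre polynomials for the weight
`(1 - t²)^m`. -/
noncomputable def legendreInner (m l l' : ℕ) : ℝ :=
  ∫ t in (-1 : ℝ)..1,
    ((1 - X ^ 2) ^ m * (derivative^[m] (legendre l) * derivative^[m] (legendre l'))).eval t

theorem legendreInner_comm (m l l' : ℕ) : legendreInner m l l' = legendreInner m l' l := by
  simp only [legendreInner, mul_comm]

open Polynomial in
-- Integration by parts against `legendre_ode`: the boundary terms vanish because of the factor `(1
-- - X ^ 2) ^ (m + 1)`.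
theorem legendreInner_succ (m l l' : ℕ) :
    legendreInner (m + 1) l l' = (((l : ℝ) - m) * (l + m + 1)) * legendreInner m l l' := by
  have h := integral_derivative_eval
    (((1 - X ^ 2) ^ (m + 1) * derivative^[m + 1] (legendre l)) * derivative^[m] (legendre l'))
  rw [derivative_mul, legendre_ode, ← Function.iterate_succ_apply' derivative] at h
  have h0 : ∀ t : ℝ, (-C (((l : ℝ) - m) * (l + m + 1)) *
      ((1 - X ^ 2) ^ m * derivative^[m] (legendre l)) * derivative^[m] (legendre l') +
      (1 - X ^ 2) ^ (m + 1) * derivative^[m + 1] (legendre l) *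
        derivative^[m.succ] (legendre l')).eval t =
      ((1 - X ^ 2) ^ (m + 1) *
        (derivative^[m + 1] (legendre l) * derivative^[m + 1] (legendre l'))).eval t -
      (((l : ℝ) - m) * (l + m + 1)) * ((1 - X ^ 2) ^ m *
        (derivative^[m] (legendre l) * derivative^[m] (legendre l'))).eval t := by
    intro t
    simp only [eval_add, eval_mul, eval_neg, eval_C, Nat.succ_eq_add_one]
    ring
  simp only [h0] at h
  rw [intervalIntegral.integral_sub, intervalIntegral.integral_const_mul] at h
  · simp only [eval_mul, eval_pow, eval_sub, eval_one, eval_X] at h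
    rw [← sub_eq_zero]
    unfold legendreInner
    simp only [eval_mul, eval_pow, eval_sub, eval_one, eval_X]
    rw [h]
    simp
  · exact (Polynomial.continuous _).intervalIntegrable _ _
  · exact ((Polynomial.continuous _).const_mul _).intervalIntegrable _ _

/-- For `m = 0`, the recursion and symmetry give l(l+1) I = l'(l'+1) I, and the difference of the
factors is (l - l')(l + l' + 1) ≠ 0. The recursion then carries the zero to all `m`. -/
theorem legendreInner_of_ne {l l' : ℕ} (h : l ≠ l') (m : ℕ) : legendreInner m l l' = 0 := by
  induction m with
  | zero =>
    have h1 := legendreInner_succ 0 l l'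
    have h2 := legendreInner_succ 0 l' l
    rw [legendreInner_comm 1 l' l, legendreInner_comm 0 l' l, h1] at h2
    have h3 : ((l : ℝ) - l') * (l + l' + 1) * legendreInner 0 l l' = 0 := by
      push_cast at h2
      linear_combination h2
    have h4 : (l : ℝ) - l' ≠ 0 := sub_ne_zero.2 (Nat.cast_injective.ne h)
    have h5 : (l : ℝ) + l' + 1 ≠ 0 := by positivity
    simpa [h4, h5] using h3
  | succ m ih => rw [legendreInner_succ, ih, mul_zero]

/-- The factors (l - m)(l + m + 1) of the recursion telescope into factorials. The still unknown
value at `m = 0` is later read off from `m = l`. -/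
theorem legendreInner_self_eq (l m : ℕ) (hm : m ≤ l) :
    legendreInner m l l * (l - m).factorial = (l + m).factorial * legendreInner 0 l l := by
  induction m with
  | zero => simp [mul_comm]
  | succ m ih =>
    have hm' : m ≤ l := by omega
    have h1 : l - m = (l - (m + 1)) + 1 := by omega
    have h2 : ((l - (m + 1) : ℕ) : ℝ) = (l : ℝ) - (m + 1) := by
      rw [Nat.cast_sub hm]; push_cast; ring
    have ih := ih hm'
    rw [h1, Nat.factorial_succ] at ih
    rw [legendreInner_succ, ← add_assoc, Nat.factorial_succ]
    push_cast at ih ⊢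
    rw [h2] at ih
    linear_combination ((l : ℝ) + m + 1) * ih

open Polynomial in
-- Integrating the derivative of X (1 - X²)^(l+1), which vanishes at ±1, gives (2l+3) B_(l+1) =
-- 2(l+1) B_l for the integrals B_l.
theorem integral_one_sub_sq_pow (l : ℕ) :
    (∫ t in (-1 : ℝ)..1, ((1 - X ^ 2 : ℝ[X]) ^ l).eval t) * (2 * l + 1).factorial =
      2 * 4 ^ l * (l.factorial : ℝ) ^ 2 := by
  induction l with
  | zero => norm_num
  | succ l ih =>
    have h := integral_derivative_eval (X * (1 - X ^ 2) ^ (l + 1))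
    have h0 : ∀ t : ℝ, (derivative (X * (1 - X ^ 2 : ℝ[X]) ^ (l + 1))).eval t =
        (2 * l + 3 : ℝ) * ((1 - X ^ 2 : ℝ[X]) ^ (l + 1)).eval t -
        (2 * (l + 1) : ℝ) * ((1 - X ^ 2 : ℝ[X]) ^ l).eval t := by
      intro t
      rw [derivative_mul, derivative_pow]
      simp
      ring
    simp only [h0] at h
    rw [intervalIntegral.integral_sub, intervalIntegral.integral_const_mul,
      intervalIntegral.integral_const_mul] at h
    · simp only [eval_mul (p := X), eval_pow (n := l + 1), eval_sub, eval_one, eval_X, eval_pow] at h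
      rw [show 2 * (l + 1) + 1 = 2 * l + 1 + 1 + 1 by ring, Nat.factorial_succ (2 * l + 1 + 1),
        Nat.factorial_succ (2 * l + 1), Nat.factorial_succ l]
      simp only [eval_sub, eval_one, eval_X, eval_pow] at ih ⊢
      push_cast
      norm_num at h
      linear_combination ((2 * l + 1).factorial * (2 * l + 2) : ℝ) * h + 4 * (l + 1) ^ 2 * ih
    · exact ((Polynomial.continuous _).const_mul _).intervalIntegrable _ _
    · exact ((Polynomial.continuous _).const_mul _).intervalIntegrable _ _

open Polynomial in
theorem iterate_derivative_legendre_self (l : ℕ) :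
    derivative^[l] (legendre l) = C (((2 * l).factorial : ℝ) / (2 ^ l * l.factorial)) := by
  have hmon : (X ^ 2 - 1 : ℝ[X]).Monic := by
    simpa using monic_X_pow_sub_C (1 : ℝ) two_ne_zero
  have hd : (X ^ 2 - 1 : ℝ[X]).natDegree = 2 := by
    simpa using natDegree_X_pow_sub_C (n := 2) (r := (1 : ℝ))
  have hdl : ((X ^ 2 - 1 : ℝ[X]) ^ l).natDegree = 2 * l := by
    rw [hmon.natDegree_pow, hd, mul_comm]
  have h : derivative^[2 * l] ((X ^ 2 - 1 : ℝ[X]) ^ l) = C ((2 * l).factorial : ℝ) := by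
    rw [eq_C_of_natDegree_le_zero
      ((natDegree_iterate_derivative _ _).trans (by rw [hdl]; simp)),
      coeff_iterate_derivative, zero_add, Nat.descFactorial_self]
    have := (hmon.pow l).coeff_natDegree
    rw [hdl] at this
    rw [this]
    simp
  rw [legendre, iterate_derivative_C_mul, ← Function.iterate_add_apply, ← two_mul, h, ← C_mul]
  congr 1
  ring

open Polynomial in
-- At `m = l` the derivative is constant, so only the integral of (1 - t²)^l remains;
-- `legendreInner_self_eq` transports the value down to `m = 0`.
theorem legendreInner_zero_self (l : ℕ) : legendreInner 0 l l = 2 / (2 * l + 1) := by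
  have h := legendreInner_self_eq l l le_rfl
  have hB := integral_one_sub_sq_pow l
  have h1 : legendreInner l l l = (((2 * l).factorial : ℝ) / (2 ^ l * l.factorial)) ^ 2 *
      ∫ t in (-1 : ℝ)..1, ((1 - X ^ 2 : ℝ[X]) ^ l).eval t := by
    rw [legendreInner, iterate_derivative_legendre_self, ← intervalIntegral.integral_const_mul]
    refine intervalIntegral.integral_congr fun t _ => ?_
    simp only [eval_mul, eval_C]
    ring
  rw [h1, Nat.sub_self, ← two_mul] at h
  rw [Nat.factorial_succ] at hB
  have hf : ((2 * l).factorial : ℝ) ≠ 0 := by positivity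
  have hf' : (l.factorial : ℝ) ≠ 0 := by positivity
  have h4 : (4 : ℝ) ^ l = (2 ^ l) ^ 2 := by rw [← pow_mul, mul_comm, pow_mul]; norm_num
  set B := ∫ t in (-1 : ℝ)..1, ((1 - X ^ 2 : ℝ[X]) ^ l).eval t
  rw [h4] at hB
  push_cast at hB h
  have hl : (2 * (l : ℝ) + 1) ≠ 0 := by positivity
  have hI : legendreInner 0 l l = ((2 * l).factorial : ℝ) / (2 ^ l * l.factorial) ^ 2 * B := by
    field_simp at h ⊢
    simp only [Nat.factorial_zero, Nat.cast_one, mul_one] at h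
    linear_combination -h
  rw [hI]
  field_simp
  linear_combination hB

/-- The norm of the `m`-th derivative of a Legendre polynomial for the weight `(1 - t²)^m`. -/
theorem legendreInner_self (l m : ℕ) (hm : m ≤ l) :
    legendreInner m l l = 2 / (2 * l + 1) * ((l + m).factorial / (l - m).factorial) := by
  have h := legendreInner_self_eq l m hm
  rw [legendreInner_zero_self] at h
  field_simp at h ⊢
  linear_combination h

/-! ### Surface measure: isometry invariance and Archimedes' theorem -/

instance : IsFiniteMeasure sigma :=
  inferInstanceAs (IsFiniteMeasure (volume : Measure (EuclideanSpace ℝ (Fin 3))).toSphere)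

/-- The action of a linear isometry on the sphere. -/
noncomputable def sphereMap (e : EuclideanSpace ℝ (Fin 3) ≃ₗᵢ[ℝ] EuclideanSpace ℝ (Fin 3)) (x : S2) : S2 :=
  ⟨e x.1, by simp⟩

open scoped Pointwise in
-- The surface measure of a set is a multiple of the volume of the cone over it, and a linear
-- isometry maps cones to cones preserving volume.
theorem measurePreserving_sphereMap
    (e : EuclideanSpace ℝ (Fin 3) ≃ₗᵢ[ℝ] EuclideanSpace ℝ (Fin 3)) :
    MeasurePreserving (sphereMap e) sigma sigma := by
  have hm : Measurable (sphereMap e) :=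
    (e.continuous.comp continuous_subtype_val).measurable.subtype_mk
  refine ⟨hm, Measure.ext fun s hs => ?_⟩
  rw [Measure.map_apply hm hs, sigma, Measure.toSphere_apply' _ (hm hs),
    Measure.toSphere_apply' _ hs]
  congr 1
  rw [← e.measurePreserving.measure_preimage_equiv (f := e.toMeasurableEquiv)
    (Set.Ioo (0 : ℝ) 1 • (Subtype.val '' s))]
  congr 1
  ext y
  simp only [Set.mem_smul, Set.mem_image, Set.mem_preimage, Subtype.exists, exists_and_right,
    exists_eq_right, LinearIsometryEquiv.coe_toMeasurableEquiv]
  constructor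
  · rintro ⟨r, hr, z, ⟨hz, hzs⟩, rfl⟩
    exact ⟨r, hr, e z, ⟨by simpa using hz, hzs⟩, by simp⟩
  · rintro ⟨r, hr, z, ⟨hz, hzs⟩, h⟩
    refine ⟨r, hr, e.symm z, ⟨by simpa using hz, ?_⟩, ?_⟩
    · simpa [sphereMap] using hzs
    · apply e.injective
      simp [← h]

theorem integral_sphereMap (e : EuclideanSpace ℝ (Fin 3) ≃ₗᵢ[ℝ] EuclideanSpace ℝ (Fin 3))
    {F : Type*} [NormedAddCommGroup F] [NormedSpace ℝ F] {f : S2 → F} (hf : Continuous f) :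
    ∫ x, f (sphereMap e x) ∂sigma = ∫ x, f x ∂sigma := by
  have h := measurePreserving_sphereMap e
  rw [← h.map_eq, integral_map h.measurable.aemeasurable hf.aestronglyMeasurable, h.map_eq]

/-- An even Gaussian moment on the line. -/
theorem integral_pow_mul_exp_neg_sq {n : ℕ} (hn : Even n) :
    ∫ t : ℝ, t ^ n * Real.exp (-t ^ 2) = Real.Gamma ((n + 1) / 2) := by
  have h1 : ∀ t : ℝ, t ^ n * Real.exp (-t ^ 2) =
      (fun s : ℝ => s ^ n * Real.exp (-s ^ 2)) |t| := fun t => by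
    simp [hn.pow_abs]
  rw [integral_congr_ae (Filter.Eventually.of_forall h1)]
  rw [integral_comp_abs (f := fun s : ℝ => s ^ n * Real.exp (-s ^ 2))]
  have h2 := integral_rpow_mul_exp_neg_rpow (p := 2) (q := n) two_pos
    (by have : (0 : ℝ) ≤ n := by positivity
        linarith)
  simp only [Real.rpow_natCast, Real.rpow_two] at h2
  rw [h2]
  ring

/-- A Gaussian moment on the half line. -/
theorem integral_Ioi_pow_mul_exp_neg_sq (n : ℕ) :
    ∫ t in Set.Ioi (0 : ℝ), t ^ n * Real.exp (-t ^ 2) = Real.Gamma ((n + 1) / 2) / 2 := by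
  have h2 := integral_rpow_mul_exp_neg_rpow (p := 2) (q := n) two_pos
    (by have : (0 : ℝ) ≤ n := by positivity
        linarith)
  simp only [Real.rpow_natCast, Real.rpow_two] at h2
  rw [h2]
  ring

theorem integral_coord_pow_mul_exp_neg_norm_sq {n : ℕ} (hn : Even n) :
    ∫ x : EuclideanSpace ℝ (Fin 3), (x 2 : ℝ) ^ n * Real.exp (-‖x‖ ^ 2) =
      Real.pi * Real.Gamma ((n + 1) / 2) := by
  have h0 := (EuclideanSpace.volume_preserving_symm_measurableEquiv_toLp (Fin 3)).integral_comp'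
    (g := fun y : Fin 3 → ℝ => ∏ i, ((y i) ^ (if i = 2 then n else 0) * Real.exp (-(y i) ^ 2)))
  rw [integral_fintype_prod_volume_eq_prod
    (f := fun (i : Fin 3) (t : ℝ) => t ^ (if i = 2 then n else 0) * Real.exp (-t ^ 2))] at h0
  rw [Fin.prod_univ_three, integral_pow_mul_exp_neg_sq (by simp), integral_pow_mul_exp_neg_sq
    (by simp), integral_pow_mul_exp_neg_sq (by simpa)] at h0
  simp only [Fin.isValue, Fin.reduceEq, if_false, if_true] at h0
  have h1 : Real.Gamma (((0 : ℕ) + 1) / 2) = Real.sqrt Real.pi := by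
    simpa using Real.Gamma_one_half_eq
  rw [h1, Real.mul_self_sqrt Real.pi_pos.le] at h0
  rw [← h0]
  congr 1
  ext x
  rw [EuclideanSpace.norm_sq_eq, Fin.sum_univ_three, Fin.prod_univ_three]
  simp only [Fin.isValue, Fin.reduceEq, if_false, if_true, pow_zero, one_mul, Real.norm_eq_abs,
    sq_abs, neg_add, Real.exp_add]
  simp
  ring

/-- The Gaussian integral of x₂^n exp(-‖x‖²) over space is computed twice, as a product of line
integrals and in polar coordinates; comparing the Gamma factors isolates the spherical integral. -/
theorem integral_height_pow_of_even {n : ℕ} (hn : Even n) :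
    ∫ x : S2, (x.1 2 : ℝ) ^ n ∂sigma = 4 * Real.pi / (n + 1) := by
  have h1 : ∫ x : EuclideanSpace ℝ (Fin 3), (x 2 : ℝ) ^ n * Real.exp (-‖x‖ ^ 2) =
      (∫ x : S2, (x.1 2 : ℝ) ^ n ∂sigma) * (Real.Gamma ((n + 2 + 1) / 2) / 2) := by
    calc _ = ∫ x : ({0}ᶜ : Set (EuclideanSpace ℝ (Fin 3))), (x.1 2 : ℝ) ^ n * Real.exp (-‖x.1‖ ^ 2)
          ∂(volume.comap Subtype.val) := by
          rw [integral_subtype_comap (measurableSet_singleton _).compl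
            fun x : EuclideanSpace ℝ (Fin 3) => (x 2 : ℝ) ^ n * Real.exp (-‖x‖ ^ 2),
            restrict_compl_singleton]
      _ = ∫ z : S2 × Set.Ioi (0 : ℝ), (z.1.1 2 : ℝ) ^ n * (z.2.1 ^ n * Real.exp (-z.2.1 ^ 2))
          ∂(sigma.prod (.volumeIoiPow 2)) := by
          have h := (volume : Measure (EuclideanSpace ℝ
            (Fin 3))).measurePreserving_homeomorphUnitSphereProd.integral_comp
            (Homeomorph.measurableEmbedding _)
            (fun z : S2 × Set.Ioi (0 : ℝ) => (z.1.1 2 : ℝ) ^ n * (z.2.1 ^ n * Real.exp (-z.2.1 ^ 2)))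
          rw [finrank_euclideanSpace_fin] at h
          rw [sigma, ← h]
          congr 1
          ext x
          have hx : ‖x.1‖ ≠ 0 := norm_ne_zero_iff.2 x.2
          simp only [homeomorphUnitSphereProd_apply_fst_coe,
            homeomorphUnitSphereProd_apply_snd_coe, PiLp.smul_apply, smul_eq_mul, mul_pow]
          field_simp
          rw [mul_assoc, ← mul_pow, one_div_mul_cancel hx, one_pow, mul_one]
      _ = (∫ x : S2, (x.1 2 : ℝ) ^ n ∂sigma) *
          ∫ r : Set.Ioi (0 : ℝ), r.1 ^ n * Real.exp (-r.1 ^ 2) ∂(Measure.volumeIoiPow 2) :=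
          integral_prod_mul (fun x : S2 => (x.1 2 : ℝ) ^ n)
            fun r : Set.Ioi (0 : ℝ) => r.1 ^ n * Real.exp (-r.1 ^ 2)
      _ = _ := by
          congr 1
          -- The exponent `n + 2` is r^n from homogeneity times the density r² of the radial
          -- measure.
          have h3 := integral_Ioi_pow_mul_exp_neg_sq (n + 2)
          push_cast at h3
          rw [← h3]
          simp only [Measure.volumeIoiPow, ENNReal.ofReal]
          rw [integral_withDensity_eq_integral_smul,
            integral_subtype_comap measurableSet_Ioi
              fun a : ℝ => Real.toNNReal (a ^ 2) • (a ^ n * Real.exp (-a ^ 2)),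
            setIntegral_congr_fun measurableSet_Ioi fun x hx => ?_]
          · rw [NNReal.smul_def, Real.coe_toNNReal _ (sq_nonneg x), smul_eq_mul]
            ring
          · exact (measurable_subtype_coe.pow_const _).real_toNNReal
  rw [integral_coord_pow_mul_exp_neg_norm_sq hn] at h1
  have h4 : Real.Gamma (((n : ℝ) + 2 + 1) / 2) =
      ((n : ℝ) + 1) / 2 * Real.Gamma ((n + 1) / 2) := by
    rw [← Real.Gamma_add_one (by positivity)]
    congr 1
    ring
  have h5 : Real.Gamma (((n : ℝ) + 1) / 2) ≠ 0 := (Real.Gamma_pos_of_pos (by positivity)).ne'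
  rw [h4] at h1
  have h6 : Real.pi = (∫ x : S2, (x.1 2 : ℝ) ^ n ∂sigma) * (((n : ℝ) + 1) / 4) := by
    apply mul_right_cancel₀ h5
    rw [h1]
    ring
  have h7 : (n : ℝ) + 1 ≠ 0 := by positivity
  rw [eq_div_iff h7]
  linear_combination -4 * h6

theorem continuous_coord (i : Fin 3) : Continuous fun x : S2 => x.1 i := by
  fun_prop

theorem integral_height_pow (n : ℕ) :
    ∫ x : S2, (x.1 2 : ℝ) ^ n ∂sigma = 2 * Real.pi * ∫ t in (-1 : ℝ)..1, t ^ n := by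
  rw [integral_pow]
  rcases Nat.even_or_odd n with hn | hn
  · rw [integral_height_pow_of_even hn, hn.add_one.neg_one_pow]
    ring
  -- Odd moments vanish by the antipodal symmetry.
  · have h := integral_sphereMap (LinearIsometryEquiv.neg ℝ) (f := fun x => x.1 2 ^ n) ((continuous_coord 2).pow n)
    have h2 : ∀ x : S2, (sphereMap (LinearIsometryEquiv.neg ℝ) x).1 2 ^ n = -(x.1 2 ^ n) := by
      intro x
      simp [sphereMap, hn.neg_pow]
    simp only [h2, integral_neg] at h
    rw [hn.add_one.neg_one_pow]
    simp only [one_pow, sub_self, zero_div, mul_zero]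
    linarith

theorem integrable_of_continuous {F : Type*} [NormedAddCommGroup F] {f : S2 → F}
    (hf : Continuous f) : Integrable f sigma :=
  hf.integrable_of_hasCompactSupport (HasCompactSupport.of_compactSpace f)

/-- Archimedes' theorem for polynomial functions of the height. -/
theorem integral_height_eval (q : Polynomial ℝ) :
    ∫ x : S2, q.eval (x.1 2) ∂sigma = 2 * Real.pi * ∫ t in (-1 : ℝ)..1, q.eval t := by
  induction q using Polynomial.induction_on' with
  | add p q hp hq =>
    simp only [Polynomial.eval_add]
    rw [integral_add, intervalIntegral.integral_add, hp, hq, mul_add]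
    · exact p.continuous.intervalIntegrable _ _
    · exact q.continuous.intervalIntegrable _ _
    · exact integrable_of_continuous (p.continuous.comp (continuous_coord 2))
    · exact integrable_of_continuous (q.continuous.comp (continuous_coord 2))
  | monomial n a =>
    simp only [Polynomial.eval_monomial]
    rw [integral_const_mul, intervalIntegral.integral_const_mul, integral_height_pow]
    ring

/-! ### Orthonormality of the spherical harmonics -/

/-- The rotation by the angle `φ` about the third axis. -/
noncomputable def rotation (φ : ℝ) :
    EuclideanSpace ℝ (Fin 3) ≃ₗᵢ[ℝ] EuclideanSpace ℝ (Fin 3) :=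
  LinearIsometry.toLinearIsometryEquiv
    { toLinearMap := Matrix.toEuclideanLin
        !![Real.cos φ, -Real.sin φ, 0; Real.sin φ, Real.cos φ, 0; 0, 0, 1]
      norm_map' := fun x => by
        rw [EuclideanSpace.norm_eq, EuclideanSpace.norm_eq, Fin.sum_univ_three,
          Fin.sum_univ_three]
        congr 1
        simp only [Real.norm_eq_abs, sq_abs, Matrix.toLpLin_apply, Matrix.mulVec, dotProduct,
          Fin.sum_univ_three]
        simp
        linear_combination (x.ofLp 0 ^ 2 + x.ofLp 1 ^ 2) * Real.sin_sq_add_cos_sq φ } rfl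

theorem rotation_apply (φ : ℝ) (x : EuclideanSpace ℝ (Fin 3)) :
    rotation φ x 0 = Real.cos φ * x 0 - Real.sin φ * x 1 ∧
    rotation φ x 1 = Real.sin φ * x 0 + Real.cos φ * x 1 ∧ rotation φ x 2 = x 2 := by
  simp [rotation, Matrix.toLpLin_apply, dotProduct, Fin.sum_univ_three]
  ring

theorem sphHarmNat_rotation (φ : ℝ) (l m : ℕ) (x : S2) :
    sphHarmNat l m (sphereMap (rotation φ) x) =
      Complex.exp (φ * Complex.I) ^ m * sphHarmNat l m x := by
  obtain ⟨h0, h1, h2⟩ := rotation_apply φ x.1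
  have h : (((Real.cos φ * x.1 0 - Real.sin φ * x.1 1 : ℝ) : ℂ) +
      Complex.I * ((Real.sin φ * x.1 0 + Real.cos φ * x.1 1 : ℝ) : ℂ)) =
      Complex.exp (φ * Complex.I) * (((x.1 0 : ℝ) : ℂ) + Complex.I * ((x.1 1 : ℝ) : ℂ)) := by
    rw [Complex.exp_mul_I]
    push_cast
    linear_combination (-Complex.sin φ * x.1 1) * Complex.I_sq
  simp only [sphHarmNat, sphereMap, h0, h1, h2]
  rw [h, mul_pow]
  ring

theorem sphHarm_rotation (φ : ℝ) (l : ℕ) (m : ℤ) (x : S2) :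
    sphHarm l m (sphereMap (rotation φ) x) =
      Complex.exp (m * φ * Complex.I) * sphHarm l m x := by
  unfold sphHarm
  split_ifs with h
  · rw [sphHarmNat_rotation, ← Complex.exp_nat_mul]
    have : (m.natAbs : ℂ) = m := by
      rw [← Int.cast_natCast, Int.natAbs_of_nonneg h]
    rw [this]
    ring_nf
  · rw [sphHarmNat_rotation, ← Complex.exp_nat_mul, map_mul, ← Complex.exp_conj]
    have : (m.natAbs : ℂ) = -m := by
      have : (m.natAbs : ℤ) = -m := by omega
      rw [← Int.cast_natCast, this, Int.cast_neg]
    simp only [map_mul, this, map_neg, Complex.conj_I, Complex.conj_ofReal, map_intCast]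
    ring_nf

theorem continuous_sphHarm (l : ℕ) (m : ℤ) : Continuous (sphHarm l m) := by
  have h : ∀ k, Continuous (sphHarmNat l k) := by
    intro k
    have := ((Polynomial.derivative^[k] (legendre l)).continuous).comp (continuous_coord 2)
    unfold sphHarmNat
    simp only [Function.comp_def] at this
    fun_prop
  unfold sphHarm
  split_ifs
  · exact h _
  · exact continuous_const.mul (Complex.continuous_conj.comp (h _))

/-- The rotation by π/(m' - m) multiplies the integrand by exp(iπ) = -1, while the integral is
rotation invariant. -/
theorem integral_conj_sphHarm_mul_of_order_ne (l l' : ℕ) {m m' : ℤ} (h : m ≠ m') :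
    ∫ x, conj (sphHarm l m x) * sphHarm l' m' x ∂sigma = 0 := by
  have hne : ((m' : ℂ) - m) ≠ 0 := by
    exact_mod_cast sub_ne_zero.2 h.symm
  have h1 := integral_sphereMap (rotation (Real.pi / (m' - m)))
    (f := fun x => conj (sphHarm l m x) * sphHarm l' m' x)
    ((Complex.continuous_conj.comp (continuous_sphHarm l m)).mul (continuous_sphHarm l' m'))
  have h2 : ∀ x, (conj (sphHarm l m (sphereMap (rotation (Real.pi / (m' - m))) x)) *
      sphHarm l' m' (sphereMap (rotation (Real.pi / (m' - m))) x)) =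
      -(conj (sphHarm l m x) * sphHarm l' m' x) := by
    intro x
    rw [sphHarm_rotation, sphHarm_rotation, map_mul, ← Complex.exp_conj]
    have : Complex.exp (conj (m * ((Real.pi / (m' - m) : ℝ) : ℂ) * Complex.I)) *
        Complex.exp (m' * ((Real.pi / (m' - m) : ℝ) : ℂ) * Complex.I) = -1 := by
      rw [← Complex.exp_add, ← Complex.exp_pi_mul_I]
      congr 1
      simp only [map_mul, Complex.conj_I, Complex.conj_ofReal, map_intCast]
      push_cast
      field_simp
      ring
    linear_combination (conj (sphHarm l m x) * sphHarm l' m' x) * this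
  simp only [h2, integral_neg] at h1
  exact CharZero.neg_eq_self_iff.mp h1

/-- The normalization constant of the spherical harmonics. -/
noncomputable def sphNorm (l m : ℕ) : ℝ :=
  Real.sqrt ((2 * l + 1) / (4 * Real.pi) * (((l - m).factorial : ℝ) / ((l + m).factorial : ℝ)))

open Polynomial in
-- For equal orders the azimuthal phases cancel and |x₀ + i x₁|² = 1 - x₂² on the sphere, so the
-- product is a real polynomial in the height, ready for Archimedes' theorem.
theorem conj_sphHarmNat_mul (l l' m : ℕ) (x : S2) :
    conj (sphHarmNat l m x) * sphHarmNat l' m x =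
      ((sphNorm l m * sphNorm l' m * ((1 - X ^ 2) ^ m *
        (derivative^[m] (legendre l) * derivative^[m] (legendre l'))).eval (x.1 2) : ℝ) : ℂ) := by
  have hx : x.1 0 ^ 2 + x.1 1 ^ 2 + x.1 2 ^ 2 = 1 := by
    have h := EuclideanSpace.norm_sq_eq x.1
    rw [norm_eq_of_mem_sphere, Fin.sum_univ_three] at h
    simpa using h.symm
  have h1 : (conj (((x.1 0 : ℝ) : ℂ) + Complex.I * ((x.1 1 : ℝ) : ℂ))) *
      (((x.1 0 : ℝ) : ℂ) + Complex.I * ((x.1 1 : ℝ) : ℂ)) = ((1 - x.1 2 ^ 2 : ℝ) : ℂ) := by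
    rw [show 1 - x.1 2 ^ 2 = x.1 0 ^ 2 + x.1 1 ^ 2 by linarith]
    simp only [map_add, map_mul, Complex.conj_I, Complex.conj_ofReal]
    push_cast
    linear_combination (-(x.1 1 : ℂ) ^ 2) * Complex.I_sq
  have h2 : ((-1 : ℂ) ^ m) * (-1) ^ m = 1 := by
    rw [← mul_pow]; simp
  simp only [sphHarmNat, ← sphNorm.eq_def, map_mul, map_pow, map_neg, map_one, Complex.conj_ofReal,
    eval_mul, eval_pow, eval_sub, eval_one, eval_X, Complex.ofReal_mul, Complex.ofReal_pow]
  rw [← h1, mul_pow]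
  linear_combination
    ((conj (((x.1 0 : ℝ) : ℂ) + Complex.I * ((x.1 1 : ℝ) : ℂ))) ^ m *
      (((x.1 0 : ℝ) : ℂ) + Complex.I * ((x.1 1 : ℝ) : ℂ)) ^ m *
      (sphNorm l m : ℂ) * (sphNorm l' m : ℂ) * (((derivative^[m] (legendre l)).eval (x.1 2) : ℝ) : ℂ)
      * (((derivative^[m] (legendre l')).eval (x.1 2) : ℝ) : ℂ)) * h2

theorem conj_sphHarm_mul (l l' : ℕ) (m : ℤ) (x : S2) :
    conj (sphHarm l m x) * sphHarm l' m x =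
      conj (sphHarmNat l m.natAbs x) * sphHarmNat l' m.natAbs x := by
  unfold sphHarm
  split_ifs with h
  · rfl
  · have h2 : ((-1 : ℂ) ^ m.natAbs) * (-1) ^ m.natAbs = 1 := by
      rw [← mul_pow]; simp
    -- For negative order the product is the conjugate of the one for positive order, which is real.
    have h3 := congrArg conj (conj_sphHarmNat_mul l l' m.natAbs x)
    rw [Complex.conj_ofReal, ← conj_sphHarmNat_mul, map_mul, Complex.conj_conj] at h3
    rw [← h3]
    simp only [map_mul, map_pow, map_neg, map_one, Complex.conj_conj]
    linear_combination (sphHarmNat l m.natAbs x * conj (sphHarmNat l' m.natAbs x)) * h2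

theorem integral_conj_sphHarm_mul_same_order (l l' : ℕ) (m : ℤ) :
    ∫ x, conj (sphHarm l m x) * sphHarm l' m x ∂sigma =
      ((sphNorm l m.natAbs * sphNorm l' m.natAbs *
        (2 * Real.pi * legendreInner m.natAbs l l') : ℝ) : ℂ) := by
  simp only [conj_sphHarm_mul, conj_sphHarmNat_mul]
  rw [integral_complex_ofReal, integral_const_mul, integral_height_eval, legendreInner]

theorem integral_conj_sphHarm_mul_of_degree_ne {l l' : ℕ} (h : l ≠ l') (m m' : ℤ) :
    ∫ x, conj (sphHarm l m x) * sphHarm l' m' x ∂sigma = 0 := by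
  by_cases hm : m = m'
  · subst hm
    rw [integral_conj_sphHarm_mul_same_order, legendreInner_of_ne h]
    simp
  · exact integral_conj_sphHarm_mul_of_order_ne l l' hm

theorem integral_conj_sphHarm_mul_self {l : ℕ} {m : ℤ} (hm : m.natAbs ≤ l) :
    ∫ x, conj (sphHarm l m x) * sphHarm l m x ∂sigma = 1 := by
  rw [integral_conj_sphHarm_mul_same_order, legendreInner_self _ _ hm, sphNorm,
    Real.mul_self_sqrt (by positivity)]
  norm_cast
  field_simp
  norm_num

/-! ### Truncated fields and Parseval's identity -/

theorem memLp_of_continuous {F : Type*} [NormedAddCommGroup F] {f : S2 → F}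
    (hf : Continuous f) (q : ℝ≥0∞) : MemLp f q sigma :=
  hf.memLp_of_hasCompactSupport (HasCompactSupport.of_compactSpace f)

theorem continuous_degreePart (α : Coeff) (l : ℕ) : Continuous (degreePart α l) :=
  continuous_finsetSum _ fun m _ => continuous_const.mul (continuous_sphHarm l m)

theorem continuous_truncField (L : ℕ) (α : Coeff) : Continuous (truncField L α) :=
  continuous_finsetSum _ fun l _ => continuous_degreePart α l

theorem field_eq_truncField {α : Coeff} {N : ℕ} (hN : ∀ l, N < l → α l = 0) :
    field α = truncField N α := by
  ext x
  refine tsum_eq_sum fun l hl => ?_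
  have : N < l := by simpa using hl
  simp [degreePart, hN l this]

theorem truncField_eq_sum_sigma (L : ℕ) (α : Coeff) (x : S2) :
    truncField L α x = ∑ i ∈ (Finset.range (L + 1)).sigma
      (fun l => (Finset.univ : Finset (Orders l))), α i.1 i.2 * sphHarm i.1 i.2 x := by
  rw [Finset.sum_sigma]
  rfl

/-- Orthonormality of the spherical harmonics. -/
theorem integral_conj_sphHarm_mul (i j : Σ l : ℕ, Orders l) :
    ∫ x, conj (sphHarm i.1 i.2 x) * sphHarm j.1 j.2 x ∂sigma = if i = j then 1 else 0 := by
  obtain ⟨l, m, hm⟩ := i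
  obtain ⟨l', m', hm'⟩ := j
  split_ifs with h
  · obtain ⟨rfl, h⟩ := Sigma.mk.inj_iff.1 h
    obtain rfl := Subtype.mk.inj (eq_of_heq h)
    refine integral_conj_sphHarm_mul_self ?_
    rw [Finset.mem_Icc] at hm
    simp only
    omega
  · by_cases hl : l = l'
    · subst hl
      refine integral_conj_sphHarm_mul_of_order_ne l l fun hmm => h ?_
      simp only at hmm
      subst hmm
      rfl
    · exact integral_conj_sphHarm_mul_of_degree_ne hl _ _

theorem integral_norm_sq_sphHarm (l : ℕ) (m : Orders l) :
    ∫ x, ‖sphHarm l m x‖ ^ 2 ∂sigma = 1 := by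
  have h := integral_conj_sphHarm_mul ⟨l, m⟩ ⟨l, m⟩
  simp only [if_true, Complex.conj_mul', ← Complex.ofReal_pow] at h
  rw [integral_complex_ofReal] at h
  exact_mod_cast h

/-- Parseval's identity for truncated fields. -/
theorem integral_norm_sq_truncField (L : ℕ) (α : Coeff) :
    ∫ x, ‖truncField L α x‖ ^ 2 ∂sigma = ∑ l ∈ Finset.range (L + 1), ‖α l‖ ^ 2 := by
  have hc : ∀ i j : Σ l : ℕ, Orders l, Integrable (fun x =>
      conj (α i.1 i.2) * α j.1 j.2 * (conj (sphHarm i.1 i.2 x) * sphHarm j.1 j.2 x)) sigma :=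
    fun i j => integrable_of_continuous (continuous_const.mul
      ((Complex.continuous_conj.comp (continuous_sphHarm _ _)).mul (continuous_sphHarm _ _)))
  have h : ((∫ x, ‖truncField L α x‖ ^ 2 ∂sigma : ℝ) : ℂ) =
      ((∑ l ∈ Finset.range (L + 1), ‖α l‖ ^ 2 : ℝ) : ℂ) := by
    rw [← integral_complex_ofReal]
    calc _ = ∫ x, ∑ i ∈ (Finset.range (L + 1)).sigma
          (fun l => (Finset.univ : Finset (Orders l))), ∑ j ∈ (Finset.range (L + 1)).sigma
          (fun l => (Finset.univ : Finset (Orders l))),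
          conj (α i.1 i.2) * α j.1 j.2 * (conj (sphHarm i.1 i.2 x) * sphHarm j.1 j.2 x)
          ∂sigma := by
          congr 1
          ext x
          rw [Complex.ofReal_pow, ← Complex.conj_mul', truncField_eq_sum_sigma, map_sum,
            Finset.sum_mul_sum]
          refine Finset.sum_congr rfl fun i _ => Finset.sum_congr rfl fun j _ => ?_
          rw [map_mul]
          ring
      _ = ∑ i ∈ (Finset.range (L + 1)).sigma
          (fun l => (Finset.univ : Finset (Orders l))), ∑ j ∈ (Finset.range (L + 1)).sigma
          (fun l => (Finset.univ : Finset (Orders l))),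
          conj (α i.1 i.2) * α j.1 j.2 * if i = j then 1 else 0 := by
          rw [integral_finsetSum _ fun i _ => integrable_finsetSum _ fun j _ => hc i j]
          refine Finset.sum_congr rfl fun i _ => ?_
          rw [integral_finsetSum _ fun j _ => hc i j]
          refine Finset.sum_congr rfl fun j _ => ?_
          rw [integral_const_mul, integral_conj_sphHarm_mul]
      _ = _ := by
          rw [Complex.ofReal_sum, Finset.sum_sigma]
          refine Finset.sum_congr rfl fun l hl => ?_
          rw [EuclideanSpace.norm_sq_eq, Complex.ofReal_sum]
          refine Finset.sum_congr rfl fun m _ => ?_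
          rw [Finset.sum_eq_single_of_mem ⟨l, m⟩ (by simpa using hl)
            (fun j _ hj => by rw [if_neg hj.symm, mul_zero])]
          rw [if_pos rfl, mul_one, Complex.conj_mul', Complex.ofReal_pow]
  exact_mod_cast h

/-! ### Expansion of the squared misfit -/

section Misfit

variable {Γ : Set S2} {To : S2 → ℝ} {F G D : S2 → ℂ}

theorem inpaint_memLp (hΓm : MeasurableSet Γ) (hG : Continuous G) :
    MemLp (inpaint Γ G) 2 sigma :=
  (memLp_of_continuous hG 2).indicator hΓm

/-- The expansion of the squared misfit about a field `G`. -/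
theorem integral_norm_sq_inpaint_sub (hΓm : MeasurableSet Γ) (hTo : MemLp To 2 sigma)
    (hG : Continuous G) (hD : Continuous D) :
    ∫ x, ‖inpaint Γ (fun y => G y - D y) x - (To x : ℂ)‖ ^ 2 ∂sigma =
      ∫ x, ‖inpaint Γ G x - (To x : ℂ)‖ ^ 2 ∂sigma -
        2 * (∫ x in Γ, conj (D x) * (G x - (To x : ℂ)) ∂sigma).re +
        ∫ x in Γ, ‖D x‖ ^ 2 ∂sigma := by
  have hT : MemLp (fun x => (To x : ℂ)) 2 sigma := hTo.ofReal
  have h1 : Integrable (fun x => ‖inpaint Γ G x - (To x : ℂ)‖ ^ 2) sigma :=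
    ((inpaint_memLp hΓm hG).sub hT).integrable_norm_pow two_ne_zero
  have h2 : Integrable (fun x => conj (D x) * (G x - (To x : ℂ))) sigma :=
    (memLp_of_continuous (Complex.continuous_conj.comp hD) 2).integrable_mul
      ((memLp_of_continuous hG 2).sub hT)
  have h3 : Integrable (fun x => ‖D x‖ ^ 2) sigma :=
    (memLp_of_continuous hD 2).integrable_norm_pow two_ne_zero
  have h2r : (∫ x in Γ, conj (D x) * (G x - (To x : ℂ)) ∂sigma).re =
      ∫ x, Γ.indicator (fun x => (conj (D x) * (G x - (To x : ℂ))).re) x ∂sigma := by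
    rw [integral_indicator hΓm]
    exact (integral_re (𝕜 := ℂ) h2.integrableOn).symm
  rw [h2r, ← integral_indicator hΓm, ← integral_const_mul, ← integral_sub h1, ← integral_add]
  · congr 1
    ext x
    by_cases hx : x ∈ Γ
    · simp only [inpaint, Set.indicator_of_mem hx]
      simp only [← Complex.normSq_eq_norm_sq, Complex.normSq_apply, Complex.sub_re,
        Complex.sub_im, Complex.mul_re, Complex.conj_re, Complex.conj_im]
      ring
    · simp [inpaint, Set.indicator_of_notMem hx]
  · exact h1.sub ((h2.re.indicator hΓm).const_mul 2)
  · exact h3.indicator hΓm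
  · exact (h2.re.indicator hΓm).const_mul 2

theorem integral_norm_sq_inpaint (hΓm : MeasurableSet Γ) (hTo : MemLp To 2 sigma)
    (hF : Continuous F) :
    ∫ x, ‖inpaint Γ F x - (To x : ℂ)‖ ^ 2 ∂sigma =
      (∫ x in Γ, conj (F x) * F x ∂sigma).re -
        2 * (∫ x in Γ, conj (F x) * (To x : ℂ) ∂sigma).re + ∫ x, To x ^ 2 ∂sigma := by
  have h := integral_norm_sq_inpaint_sub (G := fun _ => 0) (D := fun x => -F x) hΓm hTo
    continuous_const hF.neg
  have h2 : (∫ x in Γ, conj (F x) * F x ∂sigma).re = ∫ x in Γ, ‖F x‖ ^ 2 ∂sigma := by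
    simp only [Complex.conj_mul', ← Complex.ofReal_pow]
    rw [integral_complex_ofReal, Complex.ofReal_re]
  have h3 : inpaint Γ (fun _ => 0) = fun _ => 0 := Set.indicator_zero ℂ Γ
  simp only [h3, zero_sub, neg_neg, norm_neg, Complex.norm_real, map_neg, neg_mul_neg,
    Real.norm_eq_abs, sq_abs] at h
  rw [h, h2]
  ring

/-- A crude form of the Cauchy–Schwarz inequality. -/
theorem norm_setIntegral_mul_le {f g : S2 → ℂ} (hf : MemLp f 2 sigma)
    (hg : MemLp g 2 sigma) :
    ‖∫ x in Γ, f x * g x ∂sigma‖ ≤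
      (∫ x, ‖f x‖ ^ 2 ∂sigma + ∫ x, ‖g x‖ ^ 2 ∂sigma) / 2 := by
  have h1 := hf.integrable_norm_pow two_ne_zero
  have h2 := hg.integrable_norm_pow two_ne_zero
  calc ‖∫ x in Γ, f x * g x ∂sigma‖ ≤ ∫ x in Γ, ‖f x * g x‖ ∂sigma :=
        norm_integral_le_integral_norm _
    _ ≤ ∫ x, ‖f x * g x‖ ∂sigma :=
        setIntegral_le_integral (hf.integrable_mul hg).norm
          (Filter.Eventually.of_forall fun x => norm_nonneg _)
    _ ≤ ∫ x, (‖f x‖ ^ 2 + ‖g x‖ ^ 2) / 2 ∂sigma := by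
        refine integral_mono (hf.integrable_mul hg).norm ((h1.add h2).div_const 2) fun x => ?_
        simp only [norm_mul]
        nlinarith [sq_nonneg (‖f x‖ - ‖g x‖)]
    _ = _ := by rw [integral_div, integral_add h1 h2]

end Misfit

/-! ### Finite support of scaled KKT points -/

theorem norm_gram_le (Γ : Set S2) (l l' : ℕ) (m : Orders l) (m' : Orders l') :
    ‖gram Γ l m l' m'‖ ≤ 1 := by
  refine (norm_setIntegral_mul_le
    (memLp_of_continuous (Complex.continuous_conj.comp (continuous_sphHarm l m)) 2)
    (memLp_of_continuous (continuous_sphHarm l' m') 2)).trans ?_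
  simp only [Function.comp_apply, RCLike.norm_conj]
  rw [integral_norm_sq_sphHarm, integral_norm_sq_sphHarm]
  norm_num

theorem norm_obsCoeff_le (Γ : Set S2) {To : S2 → ℝ} (hTo : MemLp To 2 sigma) (l : ℕ)
    (m : Orders l) : ‖obsCoeff Γ To l m‖ ≤ (∫ x, To x ^ 2 ∂sigma + 1) / 2 := by
  refine (norm_setIntegral_mul_le hTo.ofReal
    (memLp_of_continuous (Complex.continuous_conj.comp (continuous_sphHarm l m)) 2)).trans ?_
  simp only [Function.comp_apply, RCLike.norm_conj]
  rw [integral_norm_sq_sphHarm]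
  simp

theorem card_orders (l : ℕ) : Fintype.card (Orders l) = 2 * l + 1 := by
  rw [Fintype.card_coe, Int.card_Icc]
  omega

theorem norm_le_of_forall_norm_le {l : ℕ} {v : EuclideanSpace ℂ (Orders l)} {C : ℝ}
    (hC : 0 ≤ C) (h : ∀ m, ‖v m‖ ≤ C) : ‖v‖ ≤ (2 * l + 1) * C := by
  rw [EuclideanSpace.norm_eq]
  refine Real.sqrt_le_iff.2 ⟨by positivity, ?_⟩
  calc ∑ m, ‖v m‖ ^ 2 ≤ ∑ _m : Orders l, C ^ 2 :=
        Finset.sum_le_sum fun m _ => pow_le_pow_left₀ (norm_nonneg _) (h m) 2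
    _ = (2 * l + 1) * C ^ 2 := by
        rw [Finset.sum_const, Finset.card_univ, card_orders, nsmul_eq_mul]
        push_cast
        ring
    _ ≤ ((2 * l + 1) * C) ^ 2 := by
        have : (0 : ℝ) ≤ l := by positivity
        rw [mul_pow]
        exact mul_le_mul_of_nonneg_right (by nlinarith) (sq_nonneg C)

theorem eventually_mul_lt_pow {η : ℝ} (hη : 1 < η) (C : ℝ) :
    ∀ᶠ l : ℕ in Filter.atTop, C * (2 * l + 1) < η ^ l := by
  have h1 := tendsto_pow_const_div_const_pow_of_one_lt 1 hη
  have h0 := tendsto_pow_const_div_const_pow_of_one_lt 0 hη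
  have h := ((h1.const_mul 2).add h0).const_mul C
  simp only [mul_zero, add_zero, pow_one, pow_zero] at h
  filter_upwards [h.eventually_lt_const one_pos] with l hl
  have hpos : 0 < η ^ l := pow_pos (by linarith) l
  rw [show C * (2 * ((l : ℝ) / η ^ l) + 1 / η ^ l) = C * (2 * l + 1) / η ^ l by ring,
    div_lt_one hpos] at hl
  exact hl

theorem pow_le_weight {η p : ℝ} (hη : 1 < η) (hp0 : 0 < p) (l : ℕ) : η ^ l ≤ weight η p l := by
  unfold weight
  split_ifs with h
  · simp [h]
  · have h1 : (1 : ℝ) ≤ l := by exact_mod_cast Nat.one_le_iff_ne_zero.2 h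
    exact le_mul_of_one_le_right (pow_nonneg (by linarith) l) (Real.one_le_rpow h1 hp0.le)

theorem MemEll.eventually_norm_le_rpow {η p : ℝ} (hp0 : 0 < p) (hp1 : p < 1) {α : Coeff}
    (h : MemEll η p α) : ∀ᶠ l in Filter.atTop, ‖α l‖ ≤ ‖α l‖ ^ p := by
  filter_upwards [h.1.tendsto_atTop_zero.eventually_lt_const one_pos] with l hl
  have h1 : ‖α l‖ ≤ 1 := by
    rw [sq_lt_one_iff₀ (norm_nonneg _)] at hl
    exact hl.le
  rcases (norm_nonneg (α l)).eq_or_lt with h0 | h0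
  · rw [← h0, Real.zero_rpow hp0.ne']
  · simpa using Real.rpow_le_rpow_of_exponent_ge h0 h1 hp1.le

/-- The exponential weight absorbs the factor 2l + 1, the number of orders of degree l. This makes
the series for Yα absolutely convergent, with entries bounded uniformly in degree and order. -/
theorem MemEll.summable_mul_norm {η p : ℝ} (hp0 : 0 < p) (hp1 : p < 1) (hη : 1 < η) {α : Coeff}
    (h : MemEll η p α) : Summable fun l : ℕ => (2 * l + 1) * ‖α l‖ := by
  refine Summable.of_norm_bounded_eventually_nat h.2 ?_
  filter_upwards [h.eventually_norm_le_rpow hp0 hp1, eventually_mul_lt_pow hη 1] with l h1 h2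
  rw [Real.norm_of_nonneg (by positivity)]
  exact mul_le_mul (by linarith [pow_le_weight hη hp0 l]) h1 (norm_nonneg _)
    ((pow_nonneg (by linarith) l).trans (pow_le_weight hη hp0 l))

theorem norm_gramMul_le (Γ : Set S2) {α : Coeff}
    (h : Summable fun l : ℕ => (2 * l + 1) * ‖α l‖) (l : ℕ) (m : Orders l) :
    ‖gramMul Γ α l m‖ ≤ ∑' l' : ℕ, (2 * l' + 1) * ‖α l'‖ := by
  refine tsum_of_norm_bounded h.hasSum fun l' => ?_
  calc ‖∑ m' : Orders l', gram Γ l m l' m' * α l' m'‖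
      ≤ ∑ m' : Orders l', ‖gram Γ l m l' m' * α l' m'‖ := norm_sum_le _ _
    _ ≤ ∑ _m' : Orders l', ‖α l'‖ := by
        refine Finset.sum_le_sum fun m' _ => ?_
        rw [norm_mul]
        exact (mul_le_of_le_one_left (norm_nonneg _) (norm_gram_le Γ l l' m m')).trans
          (PiLp.norm_apply_le _ _)
    _ = _ := by
        rw [Finset.sum_const, Finset.card_univ, card_orders, nsmul_eq_mul]
        push_cast
        ring

/-- A scaled KKT point has only finitely many nonzero groups. -/
theorem IsScaledKKT.exists_forall_eq_zero {η p rho : ℝ} (hp0 : 0 < p) (hp1 : p < 1)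
    (hη : 1 < η) {Γ : Set S2} {To : S2 → ℝ} (hTo : MemLp To 2 sigma) {α : Coeff}
    (h : IsScaledKKT η p rho Γ To α) : ∃ N, ∀ l, N < l → α l = 0 := by
  obtain ⟨hmem, ν, hstat, -, -, hν⟩ := h
  have hs := hmem.summable_mul_norm hp0 hp1 hη
  -- `K` bounds every entry of the residual, whatever the degree and order.
  set K : ℝ := (∑' l' : ℕ, (2 * l' + 1) * ‖α l'‖) + (∫ x, To x ^ 2 ∂sigma + 1) / 2 with hK
  have hK0 : 0 ≤ K := by
    have h1 : 0 ≤ ∑' l' : ℕ, (2 * (l' : ℝ) + 1) * ‖α l'‖ := tsum_nonneg fun l => by positivity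
    have h2 : 0 ≤ ∫ x, To x ^ 2 ∂sigma := integral_nonneg fun x => sq_nonneg _
    positivity
  have hw : ∀ l, ‖gramMul Γ α l - obsCoeff Γ To l‖ ≤ (2 * l + 1) * K := fun l =>
    norm_le_of_forall_norm_le hK0 fun m => (norm_sub_le _ _).trans
      (add_le_add (norm_gramMul_le Γ hs l m) (norm_obsCoeff_le Γ hTo l m))
  -- The constant is chosen so that 2ν(2l+1)K < p η^l beyond `N`, contradicting stationarity at a
  -- nonzero group.
  obtain ⟨N, hN⟩ := Filter.eventually_atTop.1
    ((hmem.eventually_norm_le_rpow hp0 hp1).and (eventually_mul_lt_pow hη (2 * ν * K / p)))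
  refine ⟨N, fun l hl => by_contra fun hne => ?_⟩
  obtain ⟨h1, h2⟩ := hN l hl.le
  have ha : 0 < ‖α l‖ := norm_pos_iff.2 hne
  have hwt : η ^ l ≤ weight η p l := pow_le_weight hη hp0 l
  have hwt0 : 0 ≤ weight η p l := (pow_nonneg (by linarith) l).trans hwt
  have h3 := congrArg norm (eq_neg_of_add_eq_zero_left (hstat l))
  rw [norm_neg, norm_smul, norm_smul, Real.norm_of_nonneg (by positivity),
    Real.norm_of_nonneg (by positivity)] at h3
  have h4 : p * weight η p l * (‖α l‖ * ‖α l‖) ≤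
      2 * ν * ((2 * l + 1) * K) * (‖α l‖ * ‖α l‖) := by
    calc p * weight η p l * (‖α l‖ * ‖α l‖)
        = p * weight η p l * ‖α l‖ * ‖α l‖ := by ring
      _ ≤ p * weight η p l * ‖α l‖ ^ p * ‖α l‖ := by gcongr
      _ = 2 * ν * ‖α l‖ ^ 2 * ‖gramMul Γ α l - obsCoeff Γ To l‖ := h3
      _ ≤ 2 * ν * ‖α l‖ ^ 2 * ((2 * l + 1) * K) := by gcongr; exact hw l
      _ = _ := by ring
  have h5 := le_of_mul_le_mul_right h4 (by positivity)
  have h6 : 2 * ν * ((2 * l + 1) * K) < p * η ^ l := by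
    calc 2 * ν * ((2 * l + 1) * K) = p * (2 * ν * K / p * (2 * l + 1)) := by field_simp
      _ < p * η ^ l := by gcongr
  have h7 : p * η ^ l ≤ p * weight η p l := by gcongr
  linarith

/-! ### The constraint function as a misfit -/

theorem gramMul_eq_integral (Γ : Set S2) {α : Coeff} {N : ℕ} (hN : ∀ l, N < l → α l = 0)
    (l : ℕ) (m : Orders l) :
    gramMul Γ α l m = ∫ x in Γ, conj (sphHarm l m x) * truncField N α x ∂sigma := by
  have hc : ∀ (l' : ℕ) (m' : Orders l'), Integrable (fun x =>
      conj (sphHarm l m x) * (α l' m' * sphHarm l' m' x)) (sigma.restrict Γ) := fun l' m' =>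
    (integrable_of_continuous ((Complex.continuous_conj.comp (continuous_sphHarm l m)).mul
      (continuous_const.mul (continuous_sphHarm l' m')))).integrableOn
  have h1 : gramMul Γ α l m = ∑ l' ∈ Finset.range (N + 1), ∑ m' : Orders l',
      gram Γ l m l' m' * α l' m' := by
    refine tsum_eq_sum fun l' hl' => ?_
    have : N < l' := by simpa using hl'
    simp [hN l' this]
  rw [h1]
  simp only [truncField, degreePart, Finset.mul_sum]
  rw [integral_finsetSum _ fun l' _ => integrable_finsetSum _ fun m' _ => hc l' m']
  refine Finset.sum_congr rfl fun l' _ => ?_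
  rw [integral_finsetSum _ fun m' _ => hc l' m']
  refine Finset.sum_congr rfl fun m' _ => ?_
  rw [gram, ← integral_mul_const]
  congr 1
  ext x
  ring

/-- Pairing a group of integrals against conjugate spherical harmonics with the group `α l`. -/
theorem sum_conj_mul_integral (Γ : Set S2) (α : Coeff) {f : S2 → ℂ} (hf : MemLp f 2 sigma)
    (l : ℕ) :
    ∑ m : Orders l, conj (α l m) * ∫ x in Γ, conj (sphHarm l m x) * f x ∂sigma =
      ∫ x in Γ, conj (degreePart α l x) * f x ∂sigma := by
  have hc : ∀ m : Orders l, Integrable (fun x =>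
      conj (α l m) * (conj (sphHarm l m x) * f x)) (sigma.restrict Γ) := fun m =>
    (((memLp_of_continuous (Complex.continuous_conj.comp (continuous_sphHarm l m))
      2).integrable_mul hf).const_mul _).integrableOn
  simp only [← integral_const_mul]
  rw [← integral_finsetSum _ fun m _ => hc m]
  congr 1
  ext x
  simp only [degreePart, map_sum, map_mul, Finset.sum_mul, mul_assoc]

theorem sum_integral_conj_degreePart_mul (Γ : Set S2) (α : Coeff) {f : S2 → ℂ}
    (hf : MemLp f 2 sigma) (s : Finset ℕ) :
    ∑ l ∈ s, ∫ x in Γ, conj (degreePart α l x) * f x ∂sigma =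
      ∫ x in Γ, conj (∑ l ∈ s, degreePart α l x) * f x ∂sigma := by
  rw [← integral_finsetSum]
  · simp only [map_sum, Finset.sum_mul]
  · exact fun l _ => ((memLp_of_continuous (Complex.continuous_conj.comp
      (continuous_degreePart α l)) 2).integrable_mul hf).integrableOn

theorem obsCoeff_apply (Γ : Set S2) (To : S2 → ℝ) (l : ℕ) (m : Orders l) :
    obsCoeff Γ To l m = ∫ x in Γ, conj (sphHarm l m x) * (To x : ℂ) ∂sigma := by
  simp only [obsCoeff, mul_comm]

/-- For finitely supported coefficients the constraint function is the squared misfit. -/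
theorem constraintFn_eq_integral {Γ : Set S2} (hΓm : MeasurableSet Γ) {To : S2 → ℝ}
    (hTo : MemLp To 2 sigma) {α : Coeff} {N : ℕ} (hN : ∀ l, N < l → α l = 0) :
    constraintFn Γ To α = ∫ x, ‖inpaint Γ (truncField N α) x - (To x : ℂ)‖ ^ 2 ∂sigma := by
  have key : ∀ (b : Coeff) (f : S2 → ℂ), MemLp f 2 sigma →
      (∀ l (m : Orders l), b l m = ∫ x in Γ, conj (sphHarm l m x) * f x ∂sigma) →
      hdot α b = ∫ x in Γ, conj (truncField N α x) * f x ∂sigma := by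
    intro b f hf hb
    have h1 : hdot α b = ∑ l ∈ Finset.range (N + 1), ∑ m : Orders l, conj (α l m) * b l m := by
      refine tsum_eq_sum fun l hl => ?_
      have : N < l := by simpa using hl
      simp [hN l this]
    rw [h1]
    simp only [hb, truncField]
    rw [← sum_integral_conj_degreePart_mul Γ α hf]
    exact Finset.sum_congr rfl fun l _ => sum_conj_mul_integral Γ α hf l
  rw [constraintFn, integral_norm_sq_inpaint hΓm hTo (continuous_truncField N α),
    key _ _ (memLp_of_continuous (continuous_truncField N α) 2) (gramMul_eq_integral Γ hN),
    key _ _ hTo.ofReal (obsCoeff_apply Γ To)]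
  rfl

/-! ### Stationarity, active constraint and truncation -/

/-- The stationarity condition makes each group point against its residual. -/
theorem re_inner_nonpos_of_stationary {η p ν : ℝ} (hp0 : 0 < p) (hη : 1 < η) (hν : 0 ≤ ν)
    {l : ℕ} {a w : EuclideanSpace ℂ (Orders l)}
    (h : (p * weight η p l * ‖a‖ ^ p) • a + (2 * ν * ‖a‖ ^ 2) • w = 0) :
    (inner ℂ a w).re ≤ 0 := by
  have hwt : 0 < weight η p l := (pow_pos (by linarith) l).trans_le (pow_le_weight hη hp0 l)
  by_contra! hpos
  have ha : a ≠ 0 := by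
    rintro rfl
    simp at hpos
  have ha' : 0 < ‖a‖ := norm_pos_iff.2 ha
  -- Pairing the equation with `a` gives a sum of a positive and a nonnegative real number that
  -- equals zero.
  have h1 := congrArg Complex.re (congrArg (inner ℂ a) h)
  rw [inner_add_right, inner_smul_right_eq_smul, inner_smul_right_eq_smul, inner_zero_right,
    Complex.add_re, Complex.smul_re, Complex.smul_re, inner_self_eq_norm_sq_to_K,
    Complex.zero_re] at h1
  have h2 : (((‖a‖ : ℂ)) ^ 2).re = ‖a‖ ^ 2 := by
    rw [← Complex.ofReal_pow, Complex.ofReal_re]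
  have h3 : 0 < (p * weight η p l * ‖a‖ ^ p) • ‖a‖ ^ 2 := by
    rw [smul_eq_mul]
    positivity
  have h4 : 0 ≤ (2 * ν * ‖a‖ ^ 2) • (inner ℂ a w).re := by
    rw [smul_eq_mul]
    positivity
  rw [← h2] at h3
  exact (add_pos_of_pos_of_nonneg h3 h4).ne' h1

/-- The constraint is active at a scaled KKT point when it is violated at the origin. -/
theorem IsScaledKKT.constraintFn_eq {η p rho : ℝ} (hp0 : 0 < p) (hη : 1 < η) {Γ : Set S2}
    {To : S2 → ℝ} (hrho : rho < ∫ x, To x ^ 2 ∂sigma) {α : Coeff}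
    (h : IsScaledKKT η p rho Γ To α) : constraintFn Γ To α = rho := by
  obtain ⟨-, ν, hstat, hcomp, hle, -⟩ := h
  rcases mul_eq_zero.1 hcomp with rfl | h0
  · exfalso
    have hα : ∀ l, α l = 0 := fun l => by
      by_contra hne
      have ha : 0 < ‖α l‖ := norm_pos_iff.2 hne
      have hwt : 0 < weight η p l := (pow_pos (by linarith) l).trans_le (pow_le_weight hη hp0 l)
      have h1 := hstat l
      rw [mul_zero, zero_mul, zero_smul, add_zero, smul_eq_zero] at h1
      exact h1.elim (by positivity) hne
    have : constraintFn Γ To α = ∫ x, To x ^ 2 ∂sigma := by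
      simp [constraintFn, hdot, hα]
    linarith
  · linarith

/-- The squared misfit of the truncations of a scaled KKT point: it is never below `rho`, and
equals `rho` eventually. -/
theorem IsScaledKKT.exists_misfit {η p rho : ℝ} (hp0 : 0 < p) (hp1 : p < 1) (hη : 1 < η)
    {Γ : Set S2} (hΓm : MeasurableSet Γ) {To : S2 → ℝ} (hTo : MemLp To 2 sigma)
    (hrho : rho < ∫ x, To x ^ 2 ∂sigma) {α : Coeff} (h : IsScaledKKT η p rho Γ To α) :
    ∃ N, (∀ l, N < l → α l = 0) ∧
      (∀ L, N ≤ L →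
        ∫ x, ‖inpaint Γ (truncField L α) x - (To x : ℂ)‖ ^ 2 ∂sigma = rho) ∧
      ∀ L, rho ≤ ∫ x, ‖inpaint Γ (truncField L α) x - (To x : ℂ)‖ ^ 2 ∂sigma := by
  obtain ⟨N, hN⟩ := h.exists_forall_eq_zero hp0 hp1 hη hTo
  have heq : ∀ L, N ≤ L →
      ∫ x, ‖inpaint Γ (truncField L α) x - (To x : ℂ)‖ ^ 2 ∂sigma = rho := fun L hL => by
    rw [← constraintFn_eq_integral hΓm hTo fun l hl => hN l (hL.trans_lt hl)]
    exact h.constraintFn_eq hp0 hη hrho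
  refine ⟨N, hN, heq, fun L => ?_⟩
  rcases le_total N L with hL | hL
  · exact (heq L hL).ge
  obtain ⟨-, ν, hstat, -, -, hν⟩ := h
  -- `D` collects the degrees from L + 1 to N, the part lost in truncating at `L`; expanding about
  -- the full field makes its residual, hence stationarity, appear in the cross term.
  set D : S2 → ℂ := fun x => ∑ l ∈ Finset.Ico (L + 1) (N + 1), degreePart α l x with hD
  have hDc : Continuous D := continuous_finsetSum _ fun l _ => continuous_degreePart α l
  have hsub : truncField L α = fun x => truncField N α x - D x := by
    ext x
    rw [eq_sub_iff_add_eq]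
    exact Finset.sum_range_add_sum_Ico (fun l => degreePart α l x) (by omega)
  have hT : MemLp (fun x => (To x : ℂ)) 2 sigma := hTo.ofReal
  have hTN := memLp_of_continuous (continuous_truncField N α) 2
  have hR : MemLp (fun x => truncField N α x - (To x : ℂ)) 2 sigma := hTN.sub hT
  have hw : ∀ l (m : Orders l), (gramMul Γ α l - obsCoeff Γ To l) m =
      ∫ x in Γ, conj (sphHarm l m x) * (truncField N α x - (To x : ℂ)) ∂sigma := by
    intro l m
    have hY : MemLp (fun x => conj (sphHarm l m x)) 2 sigma :=
      memLp_of_continuous (Complex.continuous_conj.comp (continuous_sphHarm l m)) 2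
    simp only [mul_sub]
    erw [integral_sub (hY.integrable_mul hTN).integrableOn (hY.integrable_mul hT).integrableOn,
      ← gramMul_eq_integral Γ hN, ← obsCoeff_apply]
    rfl
  have hcross : (∫ x in Γ, conj (D x) * (truncField N α x - (To x : ℂ)) ∂sigma).re ≤ 0 := by
    rw [hD, ← sum_integral_conj_degreePart_mul Γ α hR, Complex.re_sum]
    refine Finset.sum_nonpos fun l _ => ?_
    rw [← sum_conj_mul_integral Γ α hR]
    refine le_of_eq_of_le ?_ (re_inner_nonpos_of_stationary hp0 hη hν (hstat l))
    rw [PiLp.inner_apply]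
    exact congrArg Complex.re (Finset.sum_congr rfl fun m _ => by
      rw [← hw, RCLike.inner_apply, mul_comm])
  have hD0 : 0 ≤ ∫ x in Γ, ‖D x‖ ^ 2 ∂sigma := integral_nonneg fun x => sq_nonneg _
  rw [hsub, integral_norm_sq_inpaint_sub hΓm hTo (continuous_truncField N α) hDc, heq N le_rfl]
  linarith

/-! ### Square integrability and domination over the probability space -/

theorem toReal_eLpNorm_two_sq {X F : Type*} [MeasurableSpace X] [NormedAddCommGroup F]
    {μ : Measure X} {f : X → F} (hf : MemLp f 2 μ) :
    (eLpNorm f 2 μ).toReal ^ 2 = ∫ x, ‖f x‖ ^ 2 ∂μ := by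
  have h0 : 0 ≤ ∫ x, ‖f x‖ ^ 2 ∂μ := integral_nonneg fun x => sq_nonneg _
  rw [hf.eLpNorm_eq_integral_rpow_norm two_ne_zero ENNReal.ofNat_ne_top,
    ENNReal.toReal_ofReal (by positivity)]
  simp only [ENNReal.toReal_ofNat, Real.rpow_two]
  rw [← Real.rpow_natCast, ← Real.rpow_mul h0]
  norm_num

/-- The truncations of a finitely supported field are bounded by the field in `L²`. -/
theorem sum_norm_sq_le_toReal_eLpNorm_field_sq {α : Coeff} {N : ℕ}
    (hN : ∀ l, N < l → α l = 0) (L : ℕ) :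
    ∑ l ∈ Finset.range (L + 1), ‖α l‖ ^ 2 ≤ (eLpNorm (field α) 2 sigma).toReal ^ 2 := by
  -- Truncating at `max N L` still represents the whole field and includes every degree up to `L`.
  rw [field_eq_truncField fun l (hl : max N L < l) => hN l ((le_max_left _ _).trans_lt hl),
    toReal_eLpNorm_two_sq (memLp_of_continuous (continuous_truncField _ α) 2),
    integral_norm_sq_truncField]
  refine Finset.sum_le_sum_of_subset_of_nonneg ?_ fun l _ _ => sq_nonneg _
  exact Finset.range_subset_range.2 (by simp)

theorem integral_norm_sq_inpaint_le {Γ : Set S2} (hΓm : MeasurableSet Γ) {To : S2 → ℝ}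
    (hTo : MemLp To 2 sigma) {F : S2 → ℂ} (hF : Continuous F) :
    ∫ x, ‖inpaint Γ F x - (To x : ℂ)‖ ^ 2 ∂sigma ≤
      2 * ∫ x, ‖F x‖ ^ 2 ∂sigma + 2 * ∫ x, To x ^ 2 ∂sigma := by
  have h1 := ((memLp_of_continuous hF 2).integrable_norm_pow two_ne_zero).const_mul 2
  have h2 := hTo.integrable_sq.const_mul 2
  rw [← integral_const_mul, ← integral_const_mul, ← integral_add h1 h2]
  refine integral_mono (((inpaint_memLp hΓm hF).sub hTo.ofReal).integrable_norm_pow two_ne_zero)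
    (h1.add h2) fun x => ?_
  have h3 : ‖inpaint Γ F x‖ ≤ ‖F x‖ := norm_indicator_le_norm_self _ _
  have h4 := norm_sub_le (inpaint Γ F x) (To x : ℂ)
  rw [Complex.norm_real, Real.norm_eq_abs] at h4
  have h5 : ‖inpaint Γ F x - (To x : ℂ)‖ ≤ ‖F x‖ + |To x| := by linarith
  calc ‖inpaint Γ F x - (To x : ℂ)‖ ^ 2 ≤ (‖F x‖ + |To x|) ^ 2 :=
        pow_le_pow_left₀ (norm_nonneg _) h5 2
    _ ≤ 2 * ‖F x‖ ^ 2 + 2 * To x ^ 2 := by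
        rw [← sq_abs (To x)]
        nlinarith [sq_nonneg (‖F x‖ - |To x|)]

variable {Ω : Type*} [MeasurableSpace Ω] {P : Measure Ω}

theorem ae_memLp_of_memLp_prod [SFinite P] {To : Ω → S2 → ℝ}
    (hTo : MemLp (fun z : Ω × S2 => To z.1 z.2) 2 (P.prod sigma)) :
    ∀ᵐ ω ∂P, MemLp (To ω) 2 sigma := by
  filter_upwards [hTo.1.prodMk_left, hTo.integrable_sq.prod_right_ae] with ω h1 h2
  exact (memLp_two_iff_integrable_sq h1).2 h2

theorem memLp_truncField {α : Ω → Coeff}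
    (hα : ∀ (l : ℕ) (m : Orders l), MemLp (fun ω => α ω l m) 2 P) (L : ℕ) :
    MemLp (fun z : Ω × S2 => truncField L (α z.1) z.2) 2 (P.prod sigma) := by
  refine memLp_finsetSum _ fun l _ => memLp_finsetSum _ fun m _ => ?_
  obtain ⟨C, hC⟩ := isCompact_univ.exists_bound_of_continuousOn
    (continuous_sphHarm l m).continuousOn
  have h := (hα l m).comp_fst sigma
  refine h.of_le_mul (c := C)
    (h.1.mul (continuous_sphHarm l m).aestronglyMeasurable.comp_snd)
    (Filter.Eventually.of_forall fun z => ?_)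
  rw [norm_mul, mul_comm]
  exact mul_le_mul_of_nonneg_right (hC z.2 trivial) (norm_nonneg _)

theorem memLp_inpaint_truncField_sub {Γ : Set S2} (hΓm : MeasurableSet Γ) {To : Ω → S2 → ℝ}
    (hTo : MemLp (fun z : Ω × S2 => To z.1 z.2) 2 (P.prod sigma)) {α : Ω → Coeff}
    (hα : ∀ (l : ℕ) (m : Orders l), MemLp (fun ω => α ω l m) 2 P) (L : ℕ) :
    MemLp (fun z : Ω × S2 => inpaint Γ (truncField L (α z.1)) z.2 - (To z.1 z.2 : ℂ)) 2
      (P.prod sigma) :=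
  MemLp.sub ((memLp_truncField hα L).indicator (measurable_snd hΓm)) hTo.ofReal

/-- A random field that is Lipschitz in a square integrable quantity is bounded in `L²` by a
square integrable random variable. -/
theorem exists_memLp_bound [IsProbabilityMeasure P] {α : Ω → Coeff} (hfin : ∀ᵐ ω ∂P, ∃ N, ∀ l, N < l → α ω l = 0)
    {E : Type*} [NormedAddCommGroup E] {ξ : Ω → E} (hξ : MemLp (fun ω => ‖ξ ω‖) 2 P) {κ : ℝ≥0}
    (hLip : ∀ᵐ ω₁ ∂P, ∀ᵐ ω₂ ∂P,
      eLpNorm (fun x => field (α ω₁) x - field (α ω₂) x) 2 sigma ≤ κ * ‖ξ ω₁ - ξ ω₂‖ₑ) :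
    ∃ B : Ω → ℝ, MemLp B 2 P ∧ (∀ ω, 0 ≤ B ω) ∧
      ∀ᵐ ω ∂P, (eLpNorm (field (α ω)) 2 sigma).toReal ≤ B ω := by
  have hmem : ∀ ω, (∃ N, ∀ l, N < l → α ω l = 0) → MemLp (field (α ω)) 2 sigma := by
    rintro ω ⟨N, hN⟩
    rw [field_eq_truncField hN]
    exact memLp_of_continuous (continuous_truncField N _) 2
  -- One reference outcome suffices: the norm of the field at ω is at most its norm at `ω₀` plus
  -- κ(‖ξ ω₀‖ + ‖ξ ω‖).
  obtain ⟨ω₀, h0, hL0⟩ := (hfin.and hLip).exists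
  have hm0 := hmem ω₀ h0
  have hB : MemLp (fun ω => ((eLpNorm (field (α ω₀)) 2 sigma).toReal + (κ : ℝ) * ‖ξ ω₀‖) +
      (κ : ℝ) * ‖ξ ω‖) 2 P :=
    MemLp.add (memLp_const ((eLpNorm (field (α ω₀)) 2 sigma).toReal + (κ : ℝ) * ‖ξ ω₀‖))
      (hξ.const_mul (κ : ℝ))
  refine ⟨_, hB, fun ω => by positivity, ?_⟩
  filter_upwards [hL0, hfin] with ω hω hf
  have hm := hmem ω hf
  have h1 : eLpNorm (field (α ω)) 2 sigma ≤
      eLpNorm (field (α ω₀)) 2 sigma + κ * ‖ξ ω₀ - ξ ω‖ₑ := by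
    have h2 := eLpNorm_sub_le (p := 2) hm0.1 (hm0.1.sub hm.1) one_le_two
    rw [sub_sub_cancel] at h2
    exact h2.trans (add_le_add le_rfl hω)
  have h3 := ENNReal.toReal_mono
    (ENNReal.add_ne_top.2 ⟨hm0.2.ne, ENNReal.mul_ne_top ENNReal.coe_ne_top enorm_ne_top⟩) h1
  rw [ENNReal.toReal_add hm0.2.ne (ENNReal.mul_ne_top ENNReal.coe_ne_top enorm_ne_top),
    ENNReal.toReal_mul, toReal_enorm, ENNReal.coe_toReal] at h3
  have h4 : (κ : ℝ) * ‖ξ ω₀ - ξ ω‖ ≤ κ * (‖ξ ω₀‖ + ‖ξ ω‖) :=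
    mul_le_mul_of_nonneg_left (norm_sub_le _ _) κ.coe_nonneg
  linarith

end SphereInpainting

/-! ### Passage to the limit -/

theorem theorem5p2
    {Ω : Type*} [MeasurableSpace Ω] (P : Measure Ω) [IsProbabilityMeasure P]
    -- parameters of the model
    (p η rho : ℝ) (hp0 : 0 < p) (hp1 : p < 1) (hη : 1 < η)
    -- the observed region
    (Γ : Set SphereInpainting.S2) (hΓm : MeasurableSet Γ) (hΓ : (interior Γ).Nonempty)
    (hΓc : Γᶜ.Nonempty)
    -- the observed field
    (To : Ω → SphereInpainting.S2 → ℝ)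
    (hTo : MemLp (fun z : Ω × SphereInpainting.S2 => To z.1 z.2) 2
      (P.prod SphereInpainting.sigma))
    (hrho_lower : ∀ᵐ ω ∂P, ∫ x in Γᶜ, To ω x ^ 2 ∂SphereInpainting.sigma < rho)
    (hrho_upper : ∀ᵐ ω ∂P, rho < ∫ x, To ω x ^ 2 ∂SphereInpainting.sigma)
    -- the random scaled KKT points
    (α : Ω → SphereInpainting.Coeff)
    (hα_meas : ∀ (l : ℕ) (m : SphereInpainting.Orders l), Measurable fun ω => α ω l m)
    (hα : ∀ᵐ ω ∂P, SphereInpainting.IsScaledKKT η p rho Γ (To ω) (α ω))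
    -- the randomness `ξ` has finite second moment and the inpainted field is Lipschitz in it
    {E : Type*} [NormedAddCommGroup E] [NormedSpace ℝ E] (ξ : Ω → E)
    (hξ : MemLp (fun ω => ‖ξ ω‖) 2 P) (κ : ℝ≥0)
    (hLip : ∀ᵐ ω₁ ∂P, ∀ᵐ ω₂ ∂P,
      eLpNorm (fun x => SphereInpainting.field (α ω₁) x - SphereInpainting.field (α ω₂) x) 2
        SphereInpainting.sigma ≤ κ * ‖ξ ω₁ - ξ ω₂‖ₑ) :
    ∀ ε : ℝ, 0 < ε → ∃ L : ℕ,
      MemLp (fun z : Ω × SphereInpainting.S2 =>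
        SphereInpainting.inpaint Γ (SphereInpainting.truncField L (α z.1)) z.2 - (To z.1 z.2 : ℂ))
        2 (P.prod SphereInpainting.sigma) ∧
      0 ≤ (eLpNorm (fun z : Ω × SphereInpainting.S2 =>
        SphereInpainting.inpaint Γ (SphereInpainting.truncField L (α z.1)) z.2 - (To z.1 z.2 : ℂ))
        2 (P.prod SphereInpainting.sigma)).toReal ^ 2 - rho ∧
      (eLpNorm (fun z : Ω × SphereInpainting.S2 =>
        SphereInpainting.inpaint Γ (SphereInpainting.truncField L (α z.1)) z.2 - (To z.1 z.2 : ℂ))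
        2 (P.prod SphereInpainting.sigma)).toReal ^ 2 - rho < ε := by
  intro ε hε
  have hTo' := SphereInpainting.ae_memLp_of_memLp_prod hTo
  have hkkt : ∀ᵐ ω ∂P, ∃ N, (∀ l, N < l → α ω l = 0) ∧
      (∀ L, N ≤ L → ∫ x, ‖SphereInpainting.inpaint Γ (SphereInpainting.truncField L (α ω)) x -
        (To ω x : ℂ)‖ ^ 2 ∂SphereInpainting.sigma = rho) ∧
      ∀ L, rho ≤ ∫ x, ‖SphereInpainting.inpaint Γ (SphereInpainting.truncField L (α ω)) x -
        (To ω x : ℂ)‖ ^ 2 ∂SphereInpainting.sigma := by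
    filter_upwards [hTo', hrho_upper, hα] with ω h1 h2 h3
    exact h3.exists_misfit hp0 hp1 hη hΓm h1 h2
  have hfin : ∀ᵐ ω ∂P, ∃ N, ∀ l, N < l → α ω l = 0 := hkkt.mono fun ω ⟨N, hN, _⟩ => ⟨N, hN⟩
  obtain ⟨B, hB, hB0, hBα⟩ := SphereInpainting.exists_memLp_bound hfin hξ hLip
  have hsum : ∀ᵐ ω ∂P, ∀ L, ∑ l ∈ Finset.range (L + 1), ‖α ω l‖ ^ 2 ≤ B ω ^ 2 := by
    filter_upwards [hfin, hBα] with ω ⟨N, hN⟩ h L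
    exact (SphereInpainting.sum_norm_sq_le_toReal_eLpNorm_field_sq hN L).trans
      (pow_le_pow_left₀ ENNReal.toReal_nonneg h 2)
  -- Each coefficient is dominated by `B`, which upgrades measurability to square integrability and
  -- lets Fubini apply to the misfit.
  have hαL : ∀ (l : ℕ) (m : SphereInpainting.Orders l), MemLp (fun ω => α ω l m) 2 P := by
    intro l m
    refine hB.of_le (hα_meas l m).aestronglyMeasurable ?_
    filter_upwards [hsum] with ω hω
    rw [Real.norm_of_nonneg (hB0 ω)]
    refine (PiLp.norm_apply_le _ _).trans (abs_le_of_sq_le_sq' ?_ (hB0 ω)).2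
    exact (Finset.single_le_sum (f := fun l => ‖α ω l‖ ^ 2) (fun l _ => sq_nonneg _)
      (Finset.self_mem_range_succ l)).trans (hω l)
  have hmem := SphereInpainting.memLp_inpaint_truncField_sub hΓm hTo hαL
  have hint := fun L => (hmem L).integrable_norm_pow two_ne_zero
  have hnorm : ∀ L, (eLpNorm (fun z : Ω × SphereInpainting.S2 =>
      SphereInpainting.inpaint Γ (SphereInpainting.truncField L (α z.1)) z.2 - (To z.1 z.2 : ℂ))
      2 (P.prod SphereInpainting.sigma)).toReal ^ 2 =
      ∫ ω, ∫ x, ‖SphereInpainting.inpaint Γ (SphereInpainting.truncField L (α ω)) x -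
        (To ω x : ℂ)‖ ^ 2 ∂SphereInpainting.sigma ∂P := fun L => by
    rw [SphereInpainting.toReal_eLpNorm_two_sq (hmem L), integral_prod _ (hint L)]
  -- The inner misfit is eventually equal to `rho` for almost every ω, from an index depending on ω;
  -- the dominating function does not depend on `L`.
  have hlim := tendsto_integral_of_dominated_convergence (μ := P)
    (F := fun L ω => ∫ x, ‖SphereInpainting.inpaint Γ (SphereInpainting.truncField L (α ω)) x -
      (To ω x : ℂ)‖ ^ 2 ∂SphereInpainting.sigma) (f := fun _ => rho)
    (fun ω => 2 * B ω ^ 2 + 2 * ∫ x, To ω x ^ 2 ∂SphereInpainting.sigma)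
    (fun L => (hint L).integral_prod_left.1)
    ((hB.integrable_sq.const_mul 2).add (hTo.integrable_sq.integral_prod_left.const_mul 2))
    (fun L => by
      filter_upwards [hTo', hsum] with ω h1 h2
      rw [Real.norm_of_nonneg (integral_nonneg fun x => sq_nonneg _)]
      refine (SphereInpainting.integral_norm_sq_inpaint_le hΓm h1
        (SphereInpainting.continuous_truncField L (α ω))).trans ?_
      rw [SphereInpainting.integral_norm_sq_truncField]
      linarith [h2 L])
    (by
      filter_upwards [hkkt] with ω ⟨N, _, hN, _⟩
      exact tendsto_const_nhds.congr'
        (Filter.eventually_atTop.2 ⟨N, fun L hL => (hN L hL).symm⟩))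
  rw [integral_const, probReal_univ, one_smul] at hlim
  obtain ⟨L, hL⟩ := (hlim.eventually_lt_const (lt_add_of_pos_right rho hε)).exists
  refine ⟨L, hmem L, ?_, ?_⟩
  · rw [hnorm, sub_nonneg]
    calc rho = ∫ _, rho ∂P := by rw [integral_const, probReal_univ, one_smul]
      _ ≤ _ := integral_mono_ae (integrable_const _) (hint L).integral_prod_left
        (hkkt.mono fun ω ⟨_, _, _, h⟩ => h L)
  · rw [hnorm]
    linarith
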